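/- **Model.** Let $[n]=\{1,\dots,n\}$; graphs are simple and undirected. The independent set oracle of a graph $G=([n],E)$ is the map $\mathsf{IS}_G:2^{[n]}\to\{0,1\}$ with $\mathsf{IS}_G(U)=1$ if and only if $U$ is an independent set of $G$. A deterministic algorithm on $n$ vertices with oracle access is an adaptive decision tree: at each step it either halts and outputs a real number, or queries the oracle on a set $U\subseteq[n]$ and continues depending on the answer. A randomized algorithm is a probability distribution over such deterministic algorithms, independent of $G$, which may depend on the other inputs of the algorithm. The complexity measure is the number of oracle queries made. **Theorem 1.1.** There is a randomized algorithm that takes as input (1) an accuracy parameter $\varepsilon>0$, (2) a positive integer $n$, and (3) access to the independent set oracle of an undirected graph $G=([n],E)$ with $m=|E|\ge 1$ (the number $m$ is not given to the algorithm), and there are a polynomial $P$ in two variables with real coefficients and a function $\delta:\mathbb N\to\mathbb R$ with $\delta(n)\to 0$ as $n\to\infty$, such that for all $\varepsilon>0$, all positive integers $n$ and all such graphs $G$ the following holds. With probability at least $1-\delta(n)$ over its internal randomness, the algorithm makes no more than $$\min\!\left(\sqrt m,\ \frac{n}{\sqrt m}\right)\cdot P\!\left(\log n,\ \frac1\varepsilon\right)$$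 independent set queries and outputs a number $\widetilde m$ that satisfies $(1-\varepsilon)m\le\widetilde m\le(1+\varepsilon)m$. -/

import Mathlib

open Filter Topology

/-- The independent set oracle `IS_G` of a graph `G` on the vertex set `Fin n`: on a set `S` of
vertices it answers `true` iff `S` is an independent set of `G`. -/
noncomputable def indepSetOracle {n : ℕ} (G : SimpleGraph (Fin n)) (S : Finset (Fin n)) : Bool :=
  open Classical in decide (G.IsIndepSet (S : Set (Fin n)))

/-- A deterministic adaptive algorithm with access to an oracle that answers yes/no questions about
subsets of `Fin n`, as a (finite) decision tree: it either halts with a real number as its output,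
or asks about a set `S` and goes on in a way that depends on the answer. -/
inductive QueryTree (n : ℕ) : Type
  | output (x : ℝ) : QueryTree n
  | query (S : Finset (Fin n)) (next : Bool → QueryTree n) : QueryTree n

namespace QueryTree

/-- The output of the algorithm when its queries are answered by the oracle `f`. -/
def result {n : ℕ} (f : Finset (Fin n) → Bool) : QueryTree n → ℝ
  | output x => x
  | query S next => (next (f S)).result f

/-- The number of queries that the algorithm makes when they are answered by the oracle `f`. -/
def numQueries {n : ℕ} (f : Finset (Fin n) → Bool) : QueryTree n → ℕ
  | output _ => 0
  | query S next => (next (f S)).numQueries f + 1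

end QueryTree

/-- A randomized query algorithm on `n` vertices: a probability distribution over deterministic
ones (the internal coin tosses are independent of the input). -/
abbrev RandQueryAlg (n : ℕ) : Type := PMF (QueryTree n)

/-- The probability, over the internal randomness of `A`, that a run of `A` on the independent set
oracle of `G` has the property `p`, where `p q x` is the property of making exactly `q` queries and
outputting `x`. -/
noncomputable def RandQueryAlg.prob {n : ℕ} (A : RandQueryAlg n) (G : SimpleGraph (Fin n))
    (p : ℕ → ℝ → Prop) : ℝ :=
  (A.toOuterMeasure
    {T | p (T.numQueries (indepSetOracle G)) (T.result (indepSetOracle G))}).toReal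

/-!
The edges of `G` are counted by means of random vertex sets of rate `p`, for dyadic rates `p`. An
integer `x` of the order of `(1 + log n) * (1 + 1 / ε)` governs all accuracies.

*The rate and the heavy vertices.* Let `p` be the first of the rates `2 ^ (-j)` at which the union
of two random sets contains an edge with frequency at most `1 / x ^ 2`. As this is not yet the case
at the rate `2 * p`, a union bound gives `1 / p = O(x * √m)` (`GoodTests.first_rate`). Call a vertex
heavy if it creates an edge with at least half of the test sets of rate `p`. Then there are
`O(1 / (p * x ^ 2))` heavy vertices, light vertices have degree at most `2 / p`, and by the second
moment method there are `O(1 / (p * x) ^ 2)` edges between light vertices (`GoodTests.split`). So in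
a test set the noise of edges that do not involve a given heavy vertex `v` is small, and its degree
is estimated up to a factor `1 + O(1 / x)` from the frequency with which it creates an edge with
test sets, at the first rate at which this frequency is below `1 / x`
(`GoodTests.abs_degEst_sub_le`).

*The decomposition.* With `H` the set of heavy and `L` the set of light vertices,
`m = ∑ v ∈ H, deg v + e(L) - e(H)` (`edgesIn_univ_eq`). The difference `e(L) - e(H)` is estimated
from random sets of rate `p / x`, which rarely contain more than one edge in `L` or in `H`
(`GoodSplit.abs_integral_lightMinusHeavy_sub_le`). The sum of the degrees of the heavy vertices is
estimated from random sets of rate `p`, here called groups.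

*Finding the heavy vertices of a group.* A binary search follows only those dyadic parts of the
group that create an edge with at least half of the test sets. Whether a part does so is a monotone
property, disjoint parts of the group are independent, and so `-log` of the probability that a part
does not have the property is superadditive. Since the whole group has the property with probability
at most `1 / 2`, the expected number of queries is polynomial in `x` (`integral_descentCost_le`).

*How many groups.* The number of groups `T` is doubled until `T ≥ x ^ 8 / p` or the total weight `W`
found satisfies `W + T / p ≥ x ^ 8 * n`. By Chebyshev's inequality, with degrees bounded by `n` and
by `m`, all stages are concentrated, those that stop are accurate (`abs_stage_sub_le`), and the
number of groups is at most `min √m (n / √m)` up to powers of `x`: the first term of the minimum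
comes from `1 / p = O(x * √m)`, the second one because `T * p * m = O(x ^ 8 * n)` before the end
(`stage_size_le`, `two_mul_stage_le`).
-/

/-! ### Query programs -/

/-- A deterministic adaptive query algorithm with output in an arbitrary type: a decision tree whose
leaves carry values of `α`. For `α = ℝ` this is `QueryTree n`. -/
inductive Prog (n : ℕ) (α : Type) : Type
  | pure (a : α) : Prog n α
  | ask (S : Finset (Fin n)) (next : Bool → Prog n α) : Prog n α

namespace Prog

variable {n : ℕ} {α β ι : Type}

/-- The output of the program when its queries are answered by the oracle `f`. -/
def run (f : Finset (Fin n) → Bool) : Prog n α → α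
  | pure a => a
  | ask S next => (next (f S)).run f

/-- The number of queries made when they are answered by the oracle `f`. -/
def cost (f : Finset (Fin n) → Bool) : Prog n α → ℕ
  | pure _ => 0
  | ask S next => (next (f S)).cost f + 1

/-- Sequential composition. -/
def bind : Prog n α → (α → Prog n β) → Prog n β
  | pure a, k => k a
  | ask S next, k => ask S fun b => (next b).bind k

/-- A program with real output, as a `QueryTree`. -/
def toTree : Prog n ℝ → QueryTree n
  | pure a => .output a
  | ask S next => .query S fun b => (next b).toTree

variable (f : Finset (Fin n) → Bool)

@[simp] theorem run_pure (a : α) : (pure a : Prog n α).run f = a := rfl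

@[simp] theorem cost_pure (a : α) : (pure a : Prog n α).cost f = 0 := rfl

@[simp] theorem run_bind (P : Prog n α) (k : α → Prog n β) :
    (P.bind k).run f = (k (P.run f)).run f := by
  induction P with
  | pure a => rfl
  | ask S next ih => exact ih (f S)

@[simp] theorem cost_bind (P : Prog n α) (k : α → Prog n β) :
    (P.bind k).cost f = P.cost f + (k (P.run f)).cost f := by
  induction P with
  | pure a => simp [bind, run, cost]
  | ask S next ih => simp only [bind, run, cost, ih (f S)]; omega

theorem result_toTree (P : Prog n ℝ) : P.toTree.result f = P.run f := by
  induction P with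
  | pure a => rfl
  | ask S next ih => exact ih (f S)

theorem numQueries_toTree (P : Prog n ℝ) : P.toTree.numQueries f = P.cost f := by
  induction P with
  | pure a => rfl
  | ask S next ih => simp only [toTree, QueryTree.numQueries, cost, ih (f S)]

/-- The program that returns `1` if `S` contains an edge and `0` if `S` is independent. -/
def edgeInd (S : Finset (Fin n)) : Prog n ℝ :=
  ask S fun b => pure (if b then 0 else 1)

@[simp] theorem cost_edgeInd (S : Finset (Fin n)) : (edgeInd S).cost f = 1 := rfl

open Classical in
/-- Runs the programs `g i` for `i` in a list and collects their outputs in a function. -/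
noncomputable def tabulateList (g : ι → Prog n ℝ) : List ι → Prog n (ι → ℝ)
  | [] => pure 0
  | i :: l => (g i).bind fun a => (tabulateList g l).bind fun h => pure (Function.update h i a)

open Classical in
theorem run_tabulateList (g : ι → Prog n ℝ) (l : List ι) {i : ι} (hi : i ∈ l) :
    (tabulateList g l).run f i = (g i).run f := by
  induction l with
  | nil => simp at hi
  | cons k l ih =>
    simp only [tabulateList, run_bind, run_pure]
    by_cases h : i = k
    · subst h; simp
    · rw [Function.update_of_ne h]
      exact ih (by simpa [h] using hi)

theorem cost_tabulateList (g : ι → Prog n ℝ) (l : List ι) :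
    (tabulateList g l).cost f = (l.map fun i => (g i).cost f).sum := by
  induction l with
  | nil => rfl
  | cons k l ih => simp [tabulateList, ih]

/-- Runs the programs `g i` for all `i` and collects their outputs in a function. -/
noncomputable def tabulate [Fintype ι] (g : ι → Prog n ℝ) : Prog n (ι → ℝ) :=
  tabulateList g Finset.univ.toList

@[simp] theorem run_tabulate [Fintype ι] (g : ι → Prog n ℝ) :
    (tabulate g).run f = fun i => (g i).run f :=
  funext fun _ => run_tabulateList f g _ (by simp)

@[simp] theorem cost_tabulate [Fintype ι] (g : ι → Prog n ℝ) :
    (tabulate g).cost f = ∑ i, (g i).cost f := by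
  rw [tabulate, cost_tabulateList, Finset.sum_map_toList]

/-- Runs the programs `g i` for `i ∈ s` and adds up their outputs. -/
noncomputable def sum (s : Finset ι) (g : ι → Prog n ℝ) : Prog n ℝ :=
  (tabulateList g s.toList).bind fun h => pure (∑ i ∈ s, h i)

@[simp] theorem run_sum (s : Finset ι) (g : ι → Prog n ℝ) :
    (sum s g).run f = ∑ i ∈ s, (g i).run f := by
  simp only [sum, run_bind, run_pure]
  exact Finset.sum_congr rfl fun i hi => run_tabulateList f g _ (by simpa using hi)

@[simp] theorem cost_sum (s : Finset ι) (g : ι → Prog n ℝ) :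
    (sum s g).cost f = ∑ i ∈ s, (g i).cost f := by
  simp only [sum, cost_bind, cost_pure, cost_tabulateList, add_zero, Finset.sum_map_toList]

end Prog

section EdgeCounting

open MeasureTheory Finset

/-! ### Edges inside a random vertex set -/

/-- The indicator that the vertex set `S` is not independent in `G`. -/
noncomputable def edgeIndicator {n : ℕ} (G : SimpleGraph (Fin n)) (S : Finset (Fin n)) : ℝ :=
  if indepSetOracle G S then 0 else 1

section EdgeIndicator

variable {n : ℕ} (G : SimpleGraph (Fin n))

theorem indepSetOracle_eq_true_iff (S : Finset (Fin n)) :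
    indepSetOracle G S = true ↔ ∀ u ∈ S, ∀ v ∈ S, ¬ G.Adj u v := by
  classical
  simp only [indepSetOracle, decide_eq_true_eq, SimpleGraph.IsIndepSet, Set.Pairwise, mem_coe]
  constructor
  · intro h u hu v hv huv
    exact h hu hv huv.ne huv
  · intro h u hu v hv _
    exact h u hu v hv

theorem edgeIndicator_of_adj {S : Finset (Fin n)} {u v : Fin n} (hu : u ∈ S) (hv : v ∈ S)
    (h : G.Adj u v) : edgeIndicator G S = 1 := by
  have : ¬ indepSetOracle G S = true := fun h' =>
    (indepSetOracle_eq_true_iff G S).1 h' u hu v hv h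
  simp [edgeIndicator, this]

theorem edgeIndicator_of_not_adj {S : Finset (Fin n)} (h : ∀ u ∈ S, ∀ v ∈ S, ¬ G.Adj u v) :
    edgeIndicator G S = 0 := by
  simp [edgeIndicator, (indepSetOracle_eq_true_iff G S).2 h]

theorem edgeIndicator_nonneg (S : Finset (Fin n)) : 0 ≤ edgeIndicator G S := by
  unfold edgeIndicator; split_ifs <;> simp

theorem edgeIndicator_le_one (S : Finset (Fin n)) : edgeIndicator G S ≤ 1 := by
  unfold edgeIndicator; split_ifs <;> simp

theorem edgeIndicator_mono {S T : Finset (Fin n)} (h : S ⊆ T) :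
    edgeIndicator G S ≤ edgeIndicator G T := by
  by_cases h' : ∀ u ∈ S, ∀ v ∈ S, ¬ G.Adj u v
  · rw [edgeIndicator_of_not_adj G h']; exact edgeIndicator_nonneg G T
  · push Not at h'
    obtain ⟨u, hu, v, hv, huv⟩ := h'
    rw [edgeIndicator_of_adj G (h hu) (h hv) huv]; exact edgeIndicator_le_one G S

open Classical in
/-- The ordered pairs of adjacent vertices of `A`; there are twice as many as edges inside `A`. -/
noncomputable def adjPairs (A : Finset (Fin n)) : Finset (Fin n × Fin n) :=
  (A ×ˢ A).filter fun e => G.Adj e.1 e.2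

theorem mem_adjPairs {A : Finset (Fin n)} {e : Fin n × Fin n} :
    e ∈ adjPairs G A ↔ e.1 ∈ A ∧ e.2 ∈ A ∧ G.Adj e.1 e.2 := by
  simp [adjPairs, and_assoc]

open Classical in
/-- The number of neighbours of `v` in `A`. -/
noncomputable def degIn (A : Finset (Fin n)) (v : Fin n) : ℕ := (A.filter (G.Adj v)).card

open Classical in
theorem degIn_mono {A B : Finset (Fin n)} (h : A ⊆ B) (v : Fin n) :
    degIn G A v ≤ degIn G B v :=
  card_le_card (filter_subset_filter _ h)

open Classical in
theorem degIn_le_card (A : Finset (Fin n)) (v : Fin n) : degIn G A v ≤ A.card :=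
  card_le_card (filter_subset _ _)

theorem sum_adjPairs_fst (A : Finset (Fin n)) (g : Fin n → ℝ) :
    ∑ e ∈ adjPairs G A, g e.1 = ∑ u ∈ A, degIn G A u * g u := by
  classical
  simp only [adjPairs, sum_filter, sum_product, degIn, card_filter, Nat.cast_sum, sum_mul]
  refine sum_congr rfl fun u _ => sum_congr rfl fun v _ => ?_
  split_ifs <;> simp

theorem card_adjPairs (A : Finset (Fin n)) :
    ((adjPairs G A).card : ℝ) = ∑ u ∈ A, (degIn G A u : ℝ) := by
  simpa using sum_adjPairs_fst G A fun _ => 1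

theorem edgeIndicator_le_card_adjPairs (A : Finset (Fin n)) :
    edgeIndicator G A ≤ (adjPairs G A).card / 2 := by
  by_cases h' : ∀ u ∈ A, ∀ v ∈ A, ¬ G.Adj u v
  · rw [edgeIndicator_of_not_adj G h']; positivity
  · push Not at h'
    obtain ⟨u, hu, v, hv, huv⟩ := h'
    rw [edgeIndicator_of_adj G hu hv huv]
    have hs : ({(u, v), (v, u)} : Finset (Fin n × Fin n)) ⊆ adjPairs G A := by
      intro e he
      simp only [mem_insert, mem_singleton] at he
      rcases he with rfl | rfl
      · exact (mem_adjPairs G).2 ⟨hu, hv, huv⟩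
      · exact (mem_adjPairs G).2 ⟨hv, hu, huv.symm⟩
    have := card_le_card hs
    rw [card_pair (by simp [huv.ne])] at this
    have : (2 : ℝ) ≤ (adjPairs G A).card := by exact_mod_cast this
    linarith

/-- A lower bound for the indicator of `0 < N`, where `N` counts adjacent pairs: it is at least
`1 - (t * N - 1) ^ 2`. It involves only the first two moments of `N`. -/
theorem two_mul_sub_sq_le_edgeIndicator (A : Finset (Fin n)) (t : ℝ) :
    2 * t * (adjPairs G A).card - t ^ 2 * (adjPairs G A).card ^ 2 ≤ edgeIndicator G A := by
  by_cases h' : ∀ u ∈ A, ∀ v ∈ A, ¬ G.Adj u v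
  · have : adjPairs G A = ∅ := by
      ext e
      simp only [mem_adjPairs, notMem_empty, iff_false]
      exact fun h => h' _ h.1 _ h.2.1 h.2.2
    rw [edgeIndicator_of_not_adj G h', this]; simp
  · push Not at h'
    obtain ⟨u, hu, v, hv, huv⟩ := h'
    rw [edgeIndicator_of_adj G hu hv huv]
    nlinarith [sq_nonneg (t * (adjPairs G A).card - 1)]

/-- Each ordered pair of adjacent vertices of `A` meets few others when the degrees in `A` are at
most `D`: a weighted count of the pairs of pairs by the size of their union. -/
theorem sum_pow_card_union_le {A : Finset (Fin n)} {q D : ℝ} (hq0 : 0 ≤ q)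
    (hD : ∀ v ∈ A, (degIn G A v : ℝ) ≤ D) :
    ∑ e ∈ adjPairs G A, ∑ e' ∈ adjPairs G A, q ^ ({e.1, e.2, e'.1, e'.2} : Finset (Fin n)).card
      ≤ q ^ 4 * (adjPairs G A).card ^ 2 + 4 * q ^ 3 * D * (adjPairs G A).card
        + 2 * q ^ 2 * (adjPairs G A).card := by
  classical
  set P := adjPairs G A with hP
  have hfst : ∀ w ∈ A, ∑ e ∈ P, (if w = e.1 then (1 : ℝ) else 0) ≤ D := by
    intro w hw
    have := sum_adjPairs_fst G A fun u => if w = u then 1 else 0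
    rw [hP, this]
    simp [hw, hD w hw]
  have hsnd : ∀ w ∈ A, ∑ e ∈ P, (if w = e.2 then (1 : ℝ) else 0) ≤ D := by
    intro w hw
    have hsw : ∑ e ∈ P, (if w = e.2 then (1 : ℝ) else 0)
        = ∑ e ∈ P, (if w = e.1 then (1 : ℝ) else 0) := by
      refine sum_nbij' Prod.swap Prod.swap ?_ ?_ (by simp) (by simp) (by simp) <;>
      · intro e he
        obtain ⟨h1, h2, h3⟩ := (mem_adjPairs G).1 he
        exact (mem_adjPairs G).2 ⟨h2, h1, h3.symm⟩
    rw [hsw]; exact hfst w hw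
  have key : ∀ e ∈ P, ∀ e' ∈ P, q ^ ({e.1, e.2, e'.1, e'.2} : Finset (Fin n)).card
      ≤ q ^ 4 + q ^ 3 * ((if e.1 = e'.1 then 1 else 0) + (if e.1 = e'.2 then 1 else 0)
        + (if e.2 = e'.1 then 1 else 0) + (if e.2 = e'.2 then 1 else 0))
        + q ^ 2 * ((if e = e' then 1 else 0) + (if e.swap = e' then 1 else 0)) := by
    rintro ⟨u, v⟩ he ⟨w, z⟩ he'
    have huv : u ≠ v := ((mem_adjPairs G).1 he).2.2.ne
    have hwz : w ≠ z := ((mem_adjPairs G).1 he').2.2.ne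
    have h2 : 0 ≤ q ^ 2 := by positivity
    have h3 : 0 ≤ q ^ 3 := by positivity
    have h4 : 0 ≤ q ^ 4 := by positivity
    simp only [Prod.mk.injEq, Prod.swap_prod_mk]
    by_cases h13 : u = w
    · subst h13
      by_cases h24 : v = z
      · subst h24
        have hc : ({u, v, u, v} : Finset (Fin n)).card = 2 := by
          rw [show ({u, v, u, v} : Finset (Fin n)) = {u, v} by ext; simp]
          exact card_pair huv
        simp only [hc, huv, huv.symm, if_true, if_false, and_self]
        nlinarith
      · have hc : ({u, v, u, z} : Finset (Fin n)).card = 3 := by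
          rw [show ({u, v, u, z} : Finset (Fin n)) = {u, v, z} by ext; simp; tauto]
          exact card_eq_three.2 ⟨u, v, z, huv, hwz, h24, rfl⟩
        simp only [hc, huv.symm, hwz, h24, if_true, if_false, and_false]
        nlinarith
    · by_cases h14 : u = z
      · subst h14
        by_cases h23 : v = w
        · subst h23
          have hc : ({u, v, v, u} : Finset (Fin n)).card = 2 := by
            rw [show ({u, v, v, u} : Finset (Fin n)) = {u, v} by ext; simp; tauto]
            exact card_pair huv
          simp only [hc, huv, huv.symm, if_true, if_false, and_self]
          nlinarith
        · have hc : ({u, v, w, u} : Finset (Fin n)).card = 3 := by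
            rw [show ({u, v, w, u} : Finset (Fin n)) = {u, v, w} by ext; simp; tauto]
            exact card_eq_three.2 ⟨u, v, w, huv, h13, h23, rfl⟩
          simp only [hc, h13, huv.symm, h23, if_true, if_false, and_false, false_and]
          nlinarith
      · by_cases h23 : v = w
        · subst h23
          have hc : ({u, v, v, z} : Finset (Fin n)).card = 3 := by
            rw [show ({u, v, v, z} : Finset (Fin n)) = {u, v, z} by ext; simp]
            exact card_eq_three.2 ⟨u, v, z, huv, h14, hwz, rfl⟩
          simp only [hc, h13, h14, hwz, if_true, if_false, and_false]
          nlinarith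
        · by_cases h24 : v = z
          · subst h24
            have hc : ({u, v, w, v} : Finset (Fin n)).card = 3 := by
              rw [show ({u, v, w, v} : Finset (Fin n)) = {u, v, w} by ext; simp; tauto]
              exact card_eq_three.2 ⟨u, v, w, huv, h13, h23, rfl⟩
            simp only [hc, h13, h14, h23, if_true, if_false, and_false, false_and]
            nlinarith
          · have hc : ({u, v, w, z} : Finset (Fin n)).card = 4 := by
              rw [card_insert_of_notMem (by simp [huv, h13, h14]),
                card_insert_of_notMem (by simp [h23, h24]), card_pair hwz]
            simp only [hc, h13, h14, h23, h24, if_false, and_false]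
            simp
  have hswap : ∀ e ∈ P, e.swap ∈ P := fun e he => by
    obtain ⟨h1, h2, h3⟩ := (mem_adjPairs G).1 he
    exact (mem_adjPairs G).2 ⟨h2, h1, h3.symm⟩
  calc _ ≤ ∑ e ∈ P, (q ^ 4 * P.card + q ^ 3 * (D + D + D + D) + q ^ 2 * (1 + 1)) := by
        refine sum_le_sum fun e he => ?_
        refine (sum_le_sum (key e he)).trans ?_
        obtain ⟨h1, h2, -⟩ := (mem_adjPairs G).1 he
        rw [sum_add_distrib, sum_add_distrib, ← mul_sum, ← mul_sum, sum_add_distrib,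
          sum_add_distrib, sum_add_distrib, sum_add_distrib]
        refine add_le_add (add_le_add ?_ ?_) ?_
        · rw [sum_const, nsmul_eq_mul, mul_comm]
        · refine mul_le_mul_of_nonneg_left ?_ (by positivity)
          linarith [hfst _ h1, hfst _ h2, hsnd _ h1, hsnd _ h2]
        · refine mul_le_mul_of_nonneg_left ?_ (by positivity)
          rw [sum_ite_eq P e, sum_ite_eq P e.swap]
          simp [he, hswap e he]
    _ = _ := by rw [sum_const, nsmul_eq_mul]; ring

variable {Ω : Type*} [MeasurableSpace Ω] [Finite Ω] [MeasurableSingletonClass Ω]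

/-- The law of `U` includes every vertex independently with probability `q`: stated through the
probabilities that `U` contains given sets. -/
def HasRate (μ : Measure Ω) (U : Ω → Finset (Fin n)) (q : ℝ) : Prop :=
  ∀ T : Finset (Fin n), μ.real {ω | T ⊆ U ω} = q ^ T.card

theorem integral_ite_one_zero (μ : Measure Ω) (p : Ω → Prop) [DecidablePred p] :
    ∫ ω, (if p ω then (1 : ℝ) else 0) ∂μ = μ.real {ω | p ω} := by
  have : (fun ω => if p ω then (1 : ℝ) else 0) = Set.indicator {ω | p ω} 1 := by
    ext ω; simp [Set.indicator_apply]
  rw [this, integral_indicator_one (Set.toFinite _).measurableSet]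

variable {G} {μ : Measure Ω} [IsProbabilityMeasure μ] {U : Ω → Finset (Fin n)} {q : ℝ}

theorem card_adjPairs_inter (A S : Finset (Fin n)) :
    ((adjPairs G (S ∩ A)).card : ℝ)
      = ∑ e ∈ adjPairs G A, if ({e.1, e.2} : Finset (Fin n)) ⊆ S then 1 else 0 := by
  classical
  rw [sum_boole]
  congr 2
  ext e
  simp only [mem_adjPairs, mem_inter, mem_filter, insert_subset_iff, singleton_subset_iff]
  tauto

theorem integral_card_adjPairs (hU : HasRate μ U q) (A : Finset (Fin n)) :
    ∫ ω, ((adjPairs G (U ω ∩ A)).card : ℝ) ∂μ = q ^ 2 * (adjPairs G A).card := by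
  simp only [card_adjPairs_inter]
  rw [integral_finsetSum _ fun _ _ => Integrable.of_finite]
  rw [sum_congr rfl (g := fun _ => q ^ 2), sum_const, nsmul_eq_mul, mul_comm]
  intro e he
  rw [integral_ite_one_zero μ, hU, card_pair ((mem_adjPairs G).1 he).2.2.ne]

theorem integral_card_adjPairs_sq_le (hU : HasRate μ U q) (hq0 : 0 ≤ q)
    {A : Finset (Fin n)} {D : ℝ} (hD : ∀ v ∈ A, (degIn G A v : ℝ) ≤ D) :
    ∫ ω, ((adjPairs G (U ω ∩ A)).card : ℝ) ^ 2 ∂μ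
      ≤ q ^ 4 * (adjPairs G A).card ^ 2 + 4 * q ^ 3 * D * (adjPairs G A).card
        + 2 * q ^ 2 * (adjPairs G A).card := by
  refine le_of_eq_of_le ?_ (sum_pow_card_union_le G hq0 hD)
  have h : ∀ ω, ((adjPairs G (U ω ∩ A)).card : ℝ) ^ 2
      = ∑ e ∈ adjPairs G A, ∑ e' ∈ adjPairs G A,
        if ({e.1, e.2, e'.1, e'.2} : Finset (Fin n)) ⊆ U ω then 1 else 0 := by
    intro ω
    rw [card_adjPairs_inter, sq, sum_mul_sum]
    refine sum_congr rfl fun e _ => sum_congr rfl fun e' _ => ?_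
    simp only [insert_subset_iff, singleton_subset_iff]
    split_ifs <;> first | (simp; done) | (exfalso; tauto)
  simp only [h]
  rw [integral_finsetSum _ fun _ _ => Integrable.of_finite]
  refine sum_congr rfl fun e _ => ?_
  rw [integral_finsetSum _ fun _ _ => Integrable.of_finite]
  refine sum_congr rfl fun e' _ => ?_
  rw [integral_ite_one_zero μ, hU]

theorem integral_edgeIndicator_le (hU : HasRate μ U q) (A : Finset (Fin n)) :
    ∫ ω, edgeIndicator G (U ω ∩ A) ∂μ ≤ q ^ 2 * (adjPairs G A).card / 2 := by
  rw [← integral_card_adjPairs hU, ← integral_div]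
  exact integral_mono Integrable.of_finite Integrable.of_finite
    fun ω => edgeIndicator_le_card_adjPairs G _

/-- The second moment method: a lower bound for the probability that a random set contains an edge
of `A`, with a free parameter `t` to be chosen as about the inverse of the expected number of
adjacent pairs in the set, or as a constant if this number is small. -/
theorem le_integral_edgeIndicator (hU : HasRate μ U q) (hq0 : 0 ≤ q)
    {A : Finset (Fin n)} {D : ℝ} (hD : ∀ v ∈ A, (degIn G A v : ℝ) ≤ D) (t : ℝ) :
    2 * t * (q ^ 2 * (adjPairs G A).card) - t ^ 2 * (q ^ 4 * (adjPairs G A).card ^ 2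
      + 4 * q ^ 3 * D * (adjPairs G A).card + 2 * q ^ 2 * (adjPairs G A).card)
      ≤ ∫ ω, edgeIndicator G (U ω ∩ A) ∂μ := by
  have h := integral_mono (μ := μ) Integrable.of_finite Integrable.of_finite
    fun ω => two_mul_sub_sq_le_edgeIndicator G (U ω ∩ A) t
  rw [integral_sub Integrable.of_finite Integrable.of_finite, integral_const_mul,
    integral_const_mul, integral_card_adjPairs hU] at h
  nlinarith [integral_card_adjPairs_sq_le hU hq0 hD, sq_nonneg t]

end EdgeIndicator

/-! ### Random vertex sets -/

section RandomSubset

/-- The law of a coin that shows `true` with probability `q`. -/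
noncomputable def coin (q : unitInterval) : Measure Bool :=
  ENNReal.ofReal q • Measure.dirac true + ENNReal.ofReal (1 - q) • Measure.dirac false

instance (q : unitInterval) : IsProbabilityMeasure (coin q) := by
  constructor
  simp only [coin, Measure.add_apply, Measure.smul_apply, measure_univ, smul_eq_mul, mul_one]
  rw [← ENNReal.ofReal_add q.2.1 (by linarith [q.2.2])]
  simp

theorem coin_true (q : unitInterval) : coin q {true} = ENNReal.ofReal q := by
  simp [coin]

theorem coin_false (q : unitInterval) : coin q {false} = ENNReal.ofReal (1 - q) := by
  simp [coin]

/-- The law of the characteristic function of a random subset of `Fin n` that includes every vertex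
independently with probability `q`. -/
noncomputable def randSub (n : ℕ) (q : unitInterval) : Measure (Fin n → Bool) :=
  Measure.pi fun _ => coin q

instance (n : ℕ) (q : unitInterval) : IsProbabilityMeasure (randSub n q) := by
  unfold randSub; infer_instance

/-- The set with characteristic function `b`. -/
def supp {n : ℕ} (b : Fin n → Bool) : Finset (Fin n) := univ.filter fun v => b v = true

theorem mem_supp {n : ℕ} {b : Fin n → Bool} {v : Fin n} : v ∈ supp b ↔ b v = true := by
  simp [supp]

theorem randSub_box {n : ℕ} (q : unitInterval) (T : Finset (Fin n)) (c : Bool) :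
    (randSub n q).real {b | ∀ v ∈ T, b v = c} = (coin q).real {c} ^ T.card := by
  classical
  have : {b : Fin n → Bool | ∀ v ∈ T, b v = c}
      = Set.univ.pi fun v => if v ∈ T then {c} else Set.univ := by
    ext b
    simp only [Set.mem_ofPred_eq, Set.mem_pi, Set.mem_univ, true_implies]
    refine forall_congr' fun v => ?_
    by_cases h : v ∈ T <;> simp [h]
  rw [this, measureReal_def, randSub, Measure.pi_pi, ENNReal.toReal_prod]
  rw [← Finset.prod_subset (Finset.subset_univ T)]
  · rw [Finset.prod_congr rfl (g := fun _ => (coin q).real {c})]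
    · simp
    · intro v hv; simp [hv, measureReal_def]
  · intro v _ hv; simp only [if_neg hv, measure_univ, ENNReal.toReal_one]

theorem hasRate_randSub (n : ℕ) (q : unitInterval) : HasRate (randSub n q) supp q := by
  intro T
  have := randSub_box q T true
  simp only [measureReal_def (coin q), coin_true, ENNReal.toReal_ofReal q.2.1] at this
  rw [← this]
  congr 1
  ext b
  simp [Finset.subset_iff, mem_supp]

theorem randSub_real_disjoint {n : ℕ} (q : unitInterval) (T : Finset (Fin n)) :
    (randSub n q).real {b | Disjoint T (supp b)} = (1 - q) ^ T.card := by
  have := randSub_box q T false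
  have h1 : (0 : ℝ) ≤ 1 - q := by linarith [q.2.2]
  simp only [measureReal_def (coin q), coin_false, ENNReal.toReal_ofReal h1] at this
  rw [← this]
  congr 1
  ext b
  simp [Finset.disjoint_left, mem_supp]

theorem HasRate.prod {n : ℕ} {Ω Ω' : Type*} [MeasurableSpace Ω] [MeasurableSpace Ω']
    {μ : Measure Ω} {ν : Measure Ω'} [IsProbabilityMeasure μ] [IsProbabilityMeasure ν]
    {U : Ω → Finset (Fin n)} {V : Ω' → Finset (Fin n)} {q r : ℝ}
    (hU : HasRate μ U q) (hV : HasRate ν V r) :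
    HasRate (μ.prod ν) (fun ω => U ω.1 ∩ V ω.2) (q * r) := by
  intro T
  have : {ω : Ω × Ω' | T ⊆ U ω.1 ∩ V ω.2} = {ω | T ⊆ U ω} ×ˢ {ω | T ⊆ V ω} := by
    ext ω; simp [subset_inter_iff]
  rw [this, measureReal_prod_prod, hU, hV, mul_pow]

/-- The parts of a random set in two disjoint sets are independent. -/
theorem randSub_real_and {n : ℕ} (q : unitInterval) {A B : Finset (Fin n)} (hAB : Disjoint A B)
    (p r : Finset (Fin n) → Prop) :
    (randSub n q).real {b | p (supp b ∩ A) ∧ r (supp b ∩ B)}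
      = (randSub n q).real {b | p (supp b ∩ A)} * (randSub n q).real {b | r (supp b ∩ B)} := by
  classical
  have hi : ProbabilityTheory.iIndepFun (fun (v : Fin n) (b : Fin n → Bool) => b v)
      (randSub n q) :=
    ProbabilityTheory.iIndepFun_pi (X := fun _ b => b) fun _ => aemeasurable_id
  have hAB' := hi.indepFun_finset A B hAB fun v => measurable_pi_apply v
  let φ (C : Finset (Fin n)) (c : C → Bool) : Finset (Fin n) :=
    C.attach.filter (fun v => c v = true) |>.map (Function.Embedding.subtype _)
  have hφ : ∀ (C : Finset (Fin n)) (b : Fin n → Bool), φ C (fun v => b v) = supp b ∩ C := by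
    intro C b
    ext v
    simp [φ, mem_supp, and_comm]
  have := hAB'.measure_inter_preimage_eq_mul {c | p (φ A c)} {c | r (φ B c)}
    (Set.toFinite _).measurableSet (Set.toFinite _).measurableSet
  simp only [Set.preimage_ofPred_eq, hφ] at this
  rw [measureReal_def, measureReal_def, measureReal_def, ← ENNReal.toReal_mul, ← this]
  rfl

end RandomSubset

/-! ### Concentration of sums over independent samples -/

section Concentration

open ProbabilityTheory

variable {ι X : Type*} [Fintype ι] [Finite X] [MeasurableSpace X] [MeasurableSingletonClass X]
  {μ : ι → Measure X} [∀ i, IsProbabilityMeasure (μ i)] {ν : Measure X} {s : Finset ι}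

theorem integral_eval_pi (i : ι) (g : X → ℝ) :
    ∫ ω, g (ω i) ∂(Measure.pi μ) = ∫ y, g y ∂(μ i) := by
  classical
  rw [← (measurePreserving_eval μ i).map_eq, integral_map]
  · exact (measurable_pi_apply i).aemeasurable
  · exact (measurable_of_finite g).aestronglyMeasurable

/-- The one-sided version of Hoeffding's inequality. -/
theorem hoeffding_upper (hs : ∀ i ∈ s, μ i = ν) {g : X → ℝ} (h0 : ∀ y, 0 ≤ g y)
    (h1 : ∀ y, g y ≤ 1) {θ : ℝ} (hθ : 0 ≤ θ) :
    (Measure.pi μ).real {ω | θ * s.card ≤ ∑ i ∈ s, g (ω i) - s.card * ∫ y, g y ∂ν}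
      ≤ Real.exp (-2 * s.card * θ ^ 2) := by
  classical
  have hi : iIndepFun (fun i (ω : ι → X) => g (ω i) - ∫ y, g y ∂(μ i)) (Measure.pi μ) :=
    iIndepFun_pi (X := fun i y => g y - ∫ y, g y ∂(μ i))
      fun i => (measurable_of_finite _).aemeasurable
  have hsub : ∀ i ∈ s, HasSubgaussianMGF (fun ω : ι → X => g (ω i) - ∫ y, g y ∂(μ i))
      ((‖(1 : ℝ) - 0‖₊ / 2) ^ 2) (Measure.pi μ) := by
    intro i _
    have := hasSubgaussianMGF_of_mem_Icc (μ := Measure.pi μ) (X := fun ω => g (ω i))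
      (a := 0) (b := 1) (((measurable_of_finite g).comp (measurable_pi_apply i)).aemeasurable)
      (Eventually.of_forall fun ω => ⟨h0 _, h1 _⟩)
    rwa [integral_eval_pi] at this
  have := HasSubgaussianMGF.measure_sum_ge_le_of_iIndepFun hi hsub
    (ε := θ * s.card) (by positivity)
  convert this using 2
  · ext ω
    have hsum : ∑ i ∈ s, ∫ y, g y ∂(μ i) = s.card * ∫ y, g y ∂ν := by
      rw [← nsmul_eq_mul, ← sum_const]
      exact sum_congr rfl fun i hi => by rw [hs i hi]
    rw [Set.mem_ofPred_eq, Set.mem_ofPred_eq, sum_sub_distrib, hsum]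
  · rcases s.eq_empty_or_nonempty with rfl | hne
    · simp
    · have : (0 : ℝ) < s.card := by exact_mod_cast hne.card_pos
      simp
      field_simp

/-- **Hoeffding's inequality** for the average of a `[0, 1]`-valued function over independent
samples. -/
theorem hoeffding (hs : ∀ i ∈ s, μ i = ν) [IsProbabilityMeasure ν] {g : X → ℝ} (h0 : ∀ y, 0 ≤ g y)
    (h1 : ∀ y, g y ≤ 1) {θ : ℝ} (hθ : 0 ≤ θ) :
    (Measure.pi μ).real {ω | θ * s.card ≤ |∑ i ∈ s, g (ω i) - s.card * ∫ y, g y ∂ν|}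
      ≤ 2 * Real.exp (-2 * s.card * θ ^ 2) := by
  have hu := hoeffding_upper hs h0 h1 hθ
  have hl := hoeffding_upper hs (g := fun y => 1 - g y) (fun y => by linarith [h1 y])
    (fun y => by linarith [h0 y]) hθ
  rw [integral_sub Integrable.of_finite Integrable.of_finite] at hl
  simp only [sum_sub_distrib, sum_const, integral_const, probReal_univ, smul_eq_mul, mul_one,
    nsmul_eq_mul] at hl
  refine (measureReal_mono (s₂ := {ω | θ * s.card ≤ ∑ i ∈ s, g (ω i) - s.card * ∫ y, g y ∂ν} ∪
    {ω | θ * s.card ≤ (s.card - ∑ i ∈ s, g (ω i)) - s.card * (1 - ∫ y, g y ∂ν)}) ?_).trans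
    ((measureReal_union_le _ _).trans (by linarith))
  intro ω hω
  rw [Set.mem_ofPred_eq] at hω
  rcases le_abs.1 hω with h | h
  · exact Or.inl h
  · refine Or.inr ?_; simp only [Set.mem_ofPred_eq]; linarith

/-- **Chebyshev's inequality** for a sum over independent samples. -/
theorem chebyshev (hs : ∀ i ∈ s, μ i = ν) [IsProbabilityMeasure ν] {g : X → ℝ} {V c : ℝ}
    (hV : ∫ y, g y ^ 2 ∂ν - (∫ y, g y ∂ν) ^ 2 ≤ V) (hc : 0 < c) :
    (Measure.pi μ).real {ω | c ≤ |∑ i ∈ s, g (ω i) - s.card * ∫ y, g y ∂ν|}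
      ≤ s.card * V / c ^ 2 := by
  classical
  have hi : iIndepFun (fun i (ω : ι → X) => g (ω i)) (Measure.pi μ) :=
    iIndepFun_pi (X := fun _ y => g y) fun i => (measurable_of_finite _).aemeasurable
  have hL : ∀ h : (ι → X) → ℝ, MemLp h 2 (Measure.pi μ) := fun h => MemLp.of_discrete
  have hint : ∫ ω, (∑ i ∈ s, g (ω i)) ∂(Measure.pi μ) = s.card * ∫ y, g y ∂ν := by
    rw [integral_finsetSum _ fun _ _ => Integrable.of_finite,
      sum_congr rfl (g := fun _ => ∫ y, g y ∂ν) fun i hi => by rw [integral_eval_pi, hs i hi]]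
    simp
  have hvar : variance (∑ i ∈ s, fun ω : ι → X => g (ω i)) (Measure.pi μ) ≤ s.card * V := by
    rw [IndepFun.variance_sum (fun i _ => hL _) fun i _ j _ hij => hi.indepFun hij]
    rw [← nsmul_eq_mul]
    refine sum_le_card_nsmul _ _ _ fun i his => ?_
    rw [variance_eq_sub (hL _)]
    simp only [Pi.pow_apply]
    rw [integral_eval_pi i g, integral_eval_pi i fun y => g y ^ 2, hs i his]
    exact hV
  have := meas_ge_le_variance_div_sq (hL (∑ i ∈ s, fun ω : ι → X => g (ω i))) hc
  simp only [Finset.sum_apply, hint] at this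
  rw [measureReal_def]
  refine (ENNReal.toReal_mono ENNReal.ofReal_ne_top this).trans ?_
  rw [ENNReal.toReal_ofReal (div_nonneg (variance_nonneg _ _) (sq_nonneg _))]
  gcongr

/-- **Markov's inequality** for a sum over identically distributed samples. -/
theorem markov (hs : ∀ i ∈ s, μ i = ν) {g : X → ℝ} {E c : ℝ} (h0 : ∀ y, 0 ≤ g y)
    (hE : ∫ y, g y ∂ν ≤ E) (hc : 0 < c) :
    (Measure.pi μ).real {ω | c ≤ ∑ i ∈ s, g (ω i)} ≤ s.card * E / c := by
  have := mul_meas_ge_le_integral_of_nonneg (μ := Measure.pi μ) (f := fun ω => ∑ i ∈ s, g (ω i))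
    (Eventually.of_forall fun ω => sum_nonneg fun i _ => h0 _) Integrable.of_finite c
  rw [integral_finsetSum _ fun _ _ => Integrable.of_finite,
    sum_congr rfl (g := fun _ => ∫ y, g y ∂ν) fun i hi => by rw [integral_eval_pi, hs i hi]] at this
  rw [le_div_iff₀ hc, mul_comm]
  refine this.trans ?_
  rw [sum_const, nsmul_eq_mul]
  gcongr

end Concentration

/-! ### The algorithm -/

section Algorithm

variable {n : ℕ}

/-- The vertices in the `a`-th dyadic block of length `2 ^ ℓ`. -/
def block (n ℓ a : ℕ) : Finset (Fin n) := univ.filter fun v => v.val / 2 ^ ℓ = a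

/-- The fraction of the test sets `T i` for which `T i ∪ U` contains an edge. -/
noncomputable def hitFreq (G : SimpleGraph (Fin n)) {K : ℕ} (T : Fin K → Finset (Fin n))
    (U : Finset (Fin n)) : ℝ :=
  (∑ i, edgeIndicator G (T i ∪ U)) / K

/-- The program that computes `hitFreq`. -/
noncomputable def hitFreqProg {K : ℕ} (T : Fin K → Finset (Fin n)) (U : Finset (Fin n)) :
    Prog n ℝ :=
  (Prog.sum univ fun i => Prog.edgeInd (T i ∪ U)).bind fun s => .pure (s / K)

/-- A vertex is heavy for the test sets `T` if it creates an edge with at least half of them. -/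
noncomputable def heavySet (G : SimpleGraph (Fin n)) {K : ℕ} (T : Fin K → Finset (Fin n)) :
    Finset (Fin n) :=
  univ.filter fun v => 1 / 2 ≤ hitFreq G T {v}

/-- Binary search for the heavy vertices of `R` in a dyadic block: a part of `R` is split further
only if it creates edges with at least half of the test sets. -/
noncomputable def findHeavy {K : ℕ} (T : Fin K → Finset (Fin n)) (R : Finset (Fin n)) :
    ℕ → ℕ → Prog n (Finset (Fin n))
  | 0, a => (hitFreqProg T (R ∩ block n 0 a)).bind fun c =>
      if 1 / 2 ≤ c then .pure (R ∩ block n 0 a) else .pure ∅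
  | ℓ + 1, a => (hitFreqProg T (R ∩ block n (ℓ + 1) a)).bind fun c =>
      if 1 / 2 ≤ c then
        (findHeavy T R ℓ (2 * a)).bind fun A => (findHeavy T R ℓ (2 * a + 1)).bind fun B =>
          .pure (A ∪ B)
      else .pure ∅

open Classical in
/-- The least index with property `P`, or the last index if there is none. -/
noncomputable def leastIdx {J : ℕ} (P : Fin (J + 1) → Prop) : Fin (J + 1) :=
  if h : (univ.filter P).Nonempty then (univ.filter P).min' h else Fin.last J

/-- The estimate of the degree of a heavy vertex from its hit frequencies `F j` at the rates
`2 ^ (-j)`: at the first rate at which the frequency is small, it is nearly proportional to the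
degree. -/
noncomputable def degEstimate (x : ℕ) {J : ℕ} (j₀ : Fin (J + 1)) (F : Fin (J + 1) → ℝ) : ℝ :=
  let j := leastIdx fun j => j₀ ≤ j ∧ F j ≤ 1 / x
  F j * 2 ^ (j : ℕ)

/-- The sum of the degree estimates of the heavy vertices of `R`. -/
noncomputable def weightProg (x : ℕ) {J K : ℕ} (T : Fin (J + 1) → Fin K → Finset (Fin n))
    (j₀ : Fin (J + 1)) (R : Finset (Fin n)) : Prog n ℝ :=
  (findHeavy (T j₀) R x 0).bind fun A => Prog.sum A fun v =>
    (Prog.tabulate fun j => hitFreqProg (T j) {v}).bind fun h => .pure (degEstimate x j₀ h)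

/-- The difference of the indicators of an edge among the light and among the heavy vertices of
`R ∩ Q`. -/
noncomputable def lightMinusHeavyProg (x : ℕ) {K : ℕ} (T : Fin K → Finset (Fin n))
    (R Q : Finset (Fin n)) : Prog n ℝ :=
  (findHeavy T R x 0).bind fun A => (Prog.edgeInd ((R ∩ Q) \ A)).bind fun a =>
    (Prog.edgeInd (R ∩ Q ∩ A)).bind fun b => .pure (a - b)

open Classical in
/-- Runs the stages `W t` for `t` in a list one after the other, until the first one with a result
that satisfies `halts t`. -/
noncomputable def stageLoop {τ : Type} (W : τ → Prog n ℝ) (halts : τ → ℝ → Prop)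
    (out : τ → ℝ → ℝ) : List τ → Prog n ℝ
  | [] => .pure 0
  | t :: l => (W t).bind fun w => if halts t w then .pure (out t w) else stageLoop W halts out l

section Spec

variable (G : SimpleGraph (Fin n)) {K : ℕ} (T : Fin K → Finset (Fin n))

@[simp] theorem run_edgeInd_indepSetOracle (S : Finset (Fin n)) :
    (Prog.edgeInd S).run (indepSetOracle G) = edgeIndicator G S := rfl

@[simp] theorem run_hitFreqProg (U : Finset (Fin n)) :
    (hitFreqProg T U).run (indepSetOracle G) = hitFreq G T U := by
  simp [hitFreqProg, hitFreq]

@[simp] theorem cost_hitFreqProg (f : Finset (Fin n) → Bool) (U : Finset (Fin n)) :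
    (hitFreqProg T U).cost f = K := by
  simp [hitFreqProg]

theorem hitFreq_mono {U V : Finset (Fin n)} (h : U ⊆ V) : hitFreq G T U ≤ hitFreq G T V := by
  unfold hitFreq
  gcongr with i
  exact edgeIndicator_mono G (union_subset_union_right h)

theorem hitFreq_nonneg (U : Finset (Fin n)) : 0 ≤ hitFreq G T U :=
  div_nonneg (sum_nonneg fun _ _ => edgeIndicator_nonneg G _) (Nat.cast_nonneg _)

theorem block_succ (n ℓ a : ℕ) : block n (ℓ + 1) a = block n ℓ (2 * a) ∪ block n ℓ (2 * a + 1) := by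
  ext v
  simp only [block, mem_union, mem_filter, mem_univ, true_and, pow_succ, ← Nat.div_div_eq_div_mul]
  omega

theorem disjoint_block (n ℓ : ℕ) {a b : ℕ} (h : a ≠ b) : Disjoint (block n ℓ a) (block n ℓ b) := by
  rw [disjoint_left]
  intro v hv hv'
  simp only [block, mem_filter, mem_univ, true_and] at hv hv'
  exact h (hv.symm.trans hv')

theorem block_eq_univ {n x : ℕ} (h : n ≤ 2 ^ x) : block n x 0 = univ := by
  ext v
  simp only [block, mem_filter, mem_univ, true_and, iff_true]
  exact Nat.div_eq_of_lt (v.2.trans_le h)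

theorem inter_heavySet_of_lt {A : Finset (Fin n)} (h : ¬ 1 / 2 ≤ hitFreq G T A) :
    A ∩ heavySet G T = ∅ := by
  ext v
  simp only [heavySet, mem_inter, mem_filter, mem_univ, true_and, notMem_empty, iff_false, not_and]
  intro hv hv'
  exact h (hv'.trans (hitFreq_mono G T (by simpa using hv)))

theorem run_findHeavy (R : Finset (Fin n)) (ℓ a : ℕ) :
    (findHeavy T R ℓ a).run (indepSetOracle G) = R ∩ block n ℓ a ∩ heavySet G T := by
  induction ℓ generalizing a with
  | zero =>
    simp only [findHeavy, Prog.run_bind, run_hitFreqProg]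
    split_ifs with h
    · rw [Prog.run_pure]
      ext v
      simp only [mem_inter, heavySet, mem_filter, mem_univ, true_and, iff_self_and]
      rintro ⟨hR, hv⟩
      have : R ∩ block n 0 a = {v} := by
        ext w
        simp only [block, pow_zero, Nat.div_one, mem_inter, mem_filter, mem_univ, true_and,
          mem_singleton] at hv ⊢
        constructor
        · rintro ⟨-, hw⟩; exact Fin.ext (hw.trans hv.symm)
        · rintro rfl; exact ⟨hR, hv⟩
      rwa [this] at h
    · rw [Prog.run_pure, inter_heavySet_of_lt G T h]
  | succ ℓ ih =>
    simp only [findHeavy, Prog.run_bind, run_hitFreqProg]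
    split_ifs with h
    · simp only [Prog.run_bind, Prog.run_pure, ih, block_succ, inter_union_distrib_left,
        union_inter_distrib_right]
    · rw [Prog.run_pure, inter_heavySet_of_lt G T h]

open Classical in
/-- The number of queries of the binary search below a node, apart from those at the node. -/
noncomputable def descentCost (K : ℕ) (heavy : Finset (Fin n) → Prop) (R : Finset (Fin n)) :
    ℕ → ℕ → ℝ
  | 0, _ => 0
  | ℓ + 1, a => if heavy (R ∩ block n (ℓ + 1) a) then
      2 * K + descentCost K heavy R ℓ (2 * a) + descentCost K heavy R ℓ (2 * a + 1) else 0

theorem cost_findHeavy (R : Finset (Fin n)) (ℓ a : ℕ) :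
    ((findHeavy T R ℓ a).cost (indepSetOracle G) : ℝ)
      = K + descentCost K (fun U => 1 / 2 ≤ hitFreq G T U) R ℓ a := by
  induction ℓ generalizing a with
  | zero =>
    simp only [findHeavy, Prog.cost_bind, run_hitFreqProg, cost_hitFreqProg, descentCost]
    split_ifs <;> simp
  | succ ℓ ih =>
    simp only [findHeavy, Prog.cost_bind, run_hitFreqProg, cost_hitFreqProg, descentCost]
    split_ifs
    · simp only [Prog.cost_bind, Prog.cost_pure, Nat.cast_add, ih]
      push_cast
      ring
    · simp

/-- The value of the degree estimate of `v` in the graph `G`. -/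
noncomputable def degEst (x : ℕ) {J K : ℕ} (T : Fin (J + 1) → Fin K → Finset (Fin n))
    (j₀ : Fin (J + 1)) (v : Fin n) : ℝ :=
  degEstimate x j₀ fun j => hitFreq G (T j) {v}

theorem degEst_nonneg (x : ℕ) {J K : ℕ} (T : Fin (J + 1) → Fin K → Finset (Fin n))
    (j₀ : Fin (J + 1)) (v : Fin n) : 0 ≤ degEst G x T j₀ v :=
  mul_nonneg (hitFreq_nonneg G _ _) (by positivity)

theorem run_weightProg {x : ℕ} (hx : n ≤ 2 ^ x) {J K : ℕ}
    (T : Fin (J + 1) → Fin K → Finset (Fin n)) (j₀ : Fin (J + 1)) (R : Finset (Fin n)) :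
    (weightProg x T j₀ R).run (indepSetOracle G)
      = ∑ v ∈ R ∩ heavySet G (T j₀), degEst G x T j₀ v := by
  simp [weightProg, run_findHeavy, block_eq_univ hx, degEst]

theorem cost_weightProg {x : ℕ} (hx : n ≤ 2 ^ x) {J K : ℕ}
    (T : Fin (J + 1) → Fin K → Finset (Fin n)) (j₀ : Fin (J + 1)) (R : Finset (Fin n)) :
    ((weightProg x T j₀ R).cost (indepSetOracle G) : ℝ)
      = K + descentCost K (fun U => 1 / 2 ≤ hitFreq G (T j₀) U) R x 0
        + (R ∩ heavySet G (T j₀)).card * ((J + 1) * K) := by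
  simp [weightProg, run_findHeavy, block_eq_univ hx, cost_findHeavy]

theorem run_lightMinusHeavyProg {x : ℕ} (hx : n ≤ 2 ^ x) (R Q : Finset (Fin n)) :
    (lightMinusHeavyProg x T R Q).run (indepSetOracle G)
      = edgeIndicator G (R ∩ Q ∩ (heavySet G T)ᶜ) - edgeIndicator G (R ∩ Q ∩ heavySet G T) := by
  have h1 : (R ∩ Q) \ (R ∩ heavySet G T) = R ∩ Q ∩ (heavySet G T)ᶜ := by
    ext v; simp only [Finset.mem_sdiff, mem_inter, mem_compl]; tauto
  have h2 : R ∩ Q ∩ (R ∩ heavySet G T) = R ∩ Q ∩ heavySet G T := by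
    ext v; simp only [mem_inter]; tauto
  simp only [lightMinusHeavyProg, Prog.run_bind, Prog.run_pure, run_findHeavy, block_eq_univ hx,
    inter_univ, run_edgeInd_indepSetOracle, h1, h2]

theorem cost_lightMinusHeavyProg {x : ℕ} (R Q : Finset (Fin n)) :
    ((lightMinusHeavyProg x T R Q).cost (indepSetOracle G) : ℝ)
      = K + descentCost K (fun U => 1 / 2 ≤ hitFreq G T U) R x 0 + 2 := by
  simp [lightMinusHeavyProg, cost_findHeavy]

theorem leastIdx_spec {J : ℕ} {P : Fin (J + 1) → Prop} (h : ∃ j, P j) :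
    P (leastIdx P) ∧ ∀ j < leastIdx P, ¬ P j := by
  classical
  obtain ⟨j, hj⟩ := h
  have hne : (univ.filter P).Nonempty := ⟨j, by simpa using hj⟩
  rw [leastIdx, dif_pos hne]
  refine ⟨by simpa using (univ.filter P).min'_mem hne, fun i hi hPi => ?_⟩
  exact absurd ((univ.filter P).min'_le i (by simpa using hPi)) (not_le.2 hi)

theorem stageLoop_spec {τ : Type} [LinearOrder τ] (f : Finset (Fin n) → Bool)
    (W : τ → Prog n ℝ) (halts : τ → ℝ → Prop) (out : τ → ℝ → ℝ) {l : List τ}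
    (hl : l.Pairwise (· < ·)) (h : ∃ t ∈ l, halts t ((W t).run f)) :
    ∃ t ∈ l, halts t ((W t).run f) ∧ (∀ s ∈ l, s < t → ¬ halts s ((W s).run f)) ∧
      (stageLoop W halts out l).run f = out t ((W t).run f) ∧
      (stageLoop W halts out l).cost f ≤ ∑ s ∈ l.toFinset.filter (· ≤ t), (W s).cost f := by
  induction l with
  | nil => simp at h
  | cons a l ih =>
    rw [List.pairwise_cons] at hl
    by_cases ha : halts a ((W a).run f)
    · refine ⟨a, by simp, ha, ?_, ?_, ?_⟩
      · intro s hs hsa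
        rcases List.mem_cons.1 hs with rfl | hs
        · exact absurd hsa (lt_irrefl _)
        · exact absurd hsa (hl.1 s hs).not_gt
      · simp [stageLoop, ha]
      · simp only [stageLoop, Prog.cost_bind, ha, if_true, Prog.cost_pure, add_zero]
        exact single_le_sum (f := fun s => (W s).cost f) (fun _ _ => Nat.zero_le _) (by simp)
    · obtain ⟨t, ht, h1, h2, h3, h4⟩ := ih hl.2 (by
        obtain ⟨t, ht, hs⟩ := h
        rcases List.mem_cons.1 ht with rfl | ht
        · exact absurd hs ha
        · exact ⟨t, ht, hs⟩)
      have hat := hl.1 t ht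
      refine ⟨t, by simp [ht], h1, ?_, ?_, ?_⟩
      · intro s hs hst
        rcases List.mem_cons.1 hs with rfl | hs
        · exact ha
        · exact h2 s hs hst
      · simpa [stageLoop, ha] using h3
      · have hal : a ∉ l := fun h => lt_irrefl _ (hl.1 a h)
        rw [List.toFinset_cons, filter_insert, if_pos hat.le, sum_insert (by simp [hal])]
        simp only [stageLoop, Prog.cost_bind, ha, if_false]
        exact Nat.add_le_add_left h4 _

end Spec

end Algorithm

/-! ### Hit probabilities and the degrees of heavy and light vertices -/

section HitProb

variable {n : ℕ} (G : SimpleGraph (Fin n)) (q : unitInterval)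

/-- The probability that a random set of rate `q` together with `U` contains an edge. -/
noncomputable def hitProb (U : Finset (Fin n)) : ℝ :=
  ∫ b, edgeIndicator G (supp b ∪ U) ∂(randSub n q)

/-- The probability that the union of two independent random sets of rate `q` contains an edge. -/
noncomputable def pairProb : ℝ :=
  ∫ y, edgeIndicator G (supp y.1 ∪ supp y.2) ∂((randSub n q).prod (randSub n q))

/-- The degree of `v`, as a real number. -/
noncomputable def rdeg (v : Fin n) : ℝ := degIn G univ v

theorem rdeg_nonneg (v : Fin n) : 0 ≤ rdeg G v := Nat.cast_nonneg _

/-- The number of edges inside `A`, as a real number. -/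
noncomputable def edgesIn (A : Finset (Fin n)) : ℝ := (adjPairs G A).card / 2

theorem edgesIn_nonneg (A : Finset (Fin n)) : 0 ≤ edgesIn G A := by unfold edgesIn; positivity

variable {G q}

theorem pow_one_sub_le {q : ℝ} (h0 : 0 ≤ q) (h1 : q ≤ 1) (d : ℕ) :
    (1 - q) ^ d * (1 + d * q) ≤ 1 := by
  have hb := one_add_mul_le_pow (a := q) (by linarith) d
  have hp : 0 ≤ (1 - q) ^ d := pow_nonneg (by linarith) d
  calc (1 - q) ^ d * (1 + d * q) ≤ (1 - q) ^ d * (1 + q) ^ d := by gcongr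
    _ = (1 - q ^ 2) ^ d := by rw [← mul_pow]; ring
    _ ≤ 1 := pow_le_one₀ (by nlinarith) (by nlinarith)

/-- Disjointness probabilities decay at least harmonically. -/
theorem div_le_one_sub_pow {q : ℝ} (h0 : 0 ≤ q) (h1 : q ≤ 1) (d : ℕ) :
    d * q / (1 + d * q) ≤ 1 - (1 - q) ^ d := by
  have hpos : 0 < 1 + d * q := by positivity
  rw [div_le_iff₀ hpos]
  nlinarith [pow_one_sub_le h0 h1 d]

theorem integral_not_disjoint (T : Finset (Fin n)) :
    ∫ b, (if Disjoint T (supp b) then (0 : ℝ) else 1) ∂(randSub n q)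
      = 1 - (1 - q : ℝ) ^ T.card := by
  have : ∀ b : Fin n → Bool, (if Disjoint T (supp b) then (0 : ℝ) else 1)
      = 1 - if Disjoint T (supp b) then 1 else 0 := by
    intro b; split_ifs <;> simp
  simp only [this]
  rw [integral_sub Integrable.of_finite Integrable.of_finite, integral_ite_one_zero,
    randSub_real_disjoint]
  simp

theorem integral_card_inter {Ω : Type*} [MeasurableSpace Ω] [Finite Ω]
    [MeasurableSingletonClass Ω] {μ : Measure Ω} [IsProbabilityMeasure μ]
    {U : Ω → Finset (Fin n)} {q : ℝ} (hU : HasRate μ U q) (A : Finset (Fin n)) :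
    ∫ ω, ((U ω ∩ A).card : ℝ) ∂μ = q * A.card := by
  have : ∀ ω, ((U ω ∩ A).card : ℝ) = ∑ v ∈ A, if ({v} : Finset (Fin n)) ⊆ U ω then 1 else 0 := by
    intro ω
    rw [sum_boole, inter_comm, ← filter_mem_eq_inter]
    simp only [singleton_subset_iff]
  simp only [this]
  rw [integral_finsetSum _ fun _ _ => Integrable.of_finite,
    sum_congr rfl (g := fun _ => q)]
  · rw [sum_const, nsmul_eq_mul, mul_comm]
  · intro v _; rw [integral_ite_one_zero, hU]; simp

theorem hitProb_mono {U V : Finset (Fin n)} (h : U ⊆ V) : hitProb G q U ≤ hitProb G q V :=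
  integral_mono Integrable.of_finite Integrable.of_finite
    fun _ => edgeIndicator_mono G (union_subset_union_right h)

theorem hitProb_nonneg (U : Finset (Fin n)) : 0 ≤ hitProb G q U :=
  integral_nonneg fun _ => edgeIndicator_nonneg G _

theorem pairProb_eq :
    pairProb G q = ∫ a, hitProb G q (supp a) ∂(randSub n q) := by
  rw [pairProb, integral_prod _ Integrable.of_finite]
  simp only [hitProb, union_comm]

theorem hitProb_empty_le_pairProb : hitProb G q ∅ ≤ pairProb G q := by
  rw [pairProb_eq]
  calc hitProb G q ∅ = ∫ _, hitProb G q ∅ ∂(randSub n q) := by simp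
    _ ≤ _ := integral_mono Integrable.of_finite Integrable.of_finite
        fun a => hitProb_mono (empty_subset _)

/-- A random set that meets `A` can be replaced by one vertex of `A`. -/
theorem mul_one_sub_pow_le_pairProb {A : Finset (Fin n)} {c : ℝ}
    (hc : ∀ v ∈ A, c ≤ hitProb G q {v}) :
    c * (1 - (1 - q : ℝ) ^ A.card) ≤ pairProb G q := by
  rw [pairProb_eq, ← integral_not_disjoint, ← integral_const_mul]
  refine integral_mono Integrable.of_finite Integrable.of_finite fun a => ?_
  simp only
  split_ifs with h
  · simpa using hitProb_nonneg _
  · rw [disjoint_left] at h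
    push Not at h
    obtain ⟨v, hv, hva⟩ := h
    rw [mul_one]
    exact (hc v hv).trans (hitProb_mono (by simpa using hva))

/-- A random set that contains a neighbour of `v` has an edge together with `v`. -/
theorem one_sub_pow_le_hitProb (v : Fin n) :
    1 - (1 - q : ℝ) ^ degIn G univ v ≤ hitProb G q {v} := by
  classical
  unfold degIn
  rw [← integral_not_disjoint]
  refine integral_mono Integrable.of_finite Integrable.of_finite fun b => ?_
  simp only
  split_ifs with h
  · exact edgeIndicator_nonneg G _
  · rw [disjoint_left] at h
    push Not at h
    obtain ⟨u, hu, hub⟩ := h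
    rw [edgeIndicator_of_adj G (u := v) (v := u) (by simp) (by simp [hub]) (by simpa using hu)]

/-- An edge in the union of a random set and `{v}` joins `v` to the random set or lies inside the
random set; the second possibility is the noise in the estimates of the degree of `v`. -/
theorem hitProb_le (v : Fin n) :
    hitProb G q {v} ≤ q * rdeg G v + hitProb G q ∅ := by
  classical
  have h := integral_card_inter (hasRate_randSub n q) (univ.filter (G.Adj v))
  have h2 : rdeg G v = ((univ.filter (G.Adj v)).card : ℝ) := by
    unfold rdeg degIn; congr!
  rw [h2, ← h, hitProb, hitProb, ← integral_add Integrable.of_finite Integrable.of_finite]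
  refine integral_mono Integrable.of_finite Integrable.of_finite fun b => ?_
  simp only [union_empty]
  by_cases h : (supp b ∩ univ.filter (G.Adj v)).Nonempty
  · have : (1 : ℝ) ≤ (supp b ∩ univ.filter (G.Adj v)).card := by exact_mod_cast h.card_pos
    linarith [edgeIndicator_le_one G (supp b ∪ {v}), edgeIndicator_nonneg G (supp b)]
  · have hle : edgeIndicator G (supp b ∪ {v}) ≤ edgeIndicator G (supp b) := by
      by_cases h0 : ∀ u ∈ supp b, ∀ w ∈ supp b, ¬ G.Adj u w
      · rw [edgeIndicator_of_not_adj]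
        · exact edgeIndicator_nonneg G _
        · have hv : ∀ u ∈ supp b, ¬ G.Adj v u := fun u hu hvu =>
            h ⟨u, by simp [hu, hvu]⟩
          intro u hu w hw huw
          simp only [mem_union, mem_singleton] at hu hw
          rcases hu with hu | rfl <;> rcases hw with hw | rfl
          · exact h0 u hu w hw huw
          · exact hv u hu huw.symm
          · exact hv w hw huw
          · exact huw.ne rfl
      · push Not at h0
        obtain ⟨u, hu, w, hw, huw⟩ := h0
        rw [edgeIndicator_of_adj G hu hw huw]
        exact edgeIndicator_le_one G _
    have : (0 : ℝ) ≤ (supp b ∩ univ.filter (G.Adj v)).card := by positivity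
    linarith

theorem edgeIndicator_le_card_add (S A : Finset (Fin n)) :
    edgeIndicator G S ≤ (S ∩ A).card + edgeIndicator G (S ∩ Aᶜ) := by
  by_cases h : (S ∩ A).Nonempty
  · have : (1 : ℝ) ≤ (S ∩ A).card := by exact_mod_cast h.card_pos
    linarith [edgeIndicator_le_one G S, edgeIndicator_nonneg G (S ∩ Aᶜ)]
  · have : S ∩ Aᶜ = S := by
      rw [inter_eq_left]
      intro v hv
      rw [mem_compl]
      exact fun hA => h ⟨v, by simp [hv, hA]⟩
    rw [this]
    have : (0 : ℝ) ≤ (S ∩ A).card := by positivity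
    linarith

/-- An edge inside a random set needs a vertex of `A` or an edge outside of `A`. -/
theorem hitProb_empty_le (A : Finset (Fin n)) :
    hitProb G q ∅ ≤ q * A.card + (q : ℝ) ^ 2 * edgesIn G Aᶜ := by
  have h1 := integral_card_inter (hasRate_randSub n q) A
  have h2 := integral_edgeIndicator_le (G := G) (hasRate_randSub n q) Aᶜ
  rw [edgesIn, ← mul_div_assoc]
  refine le_trans ?_ (add_le_add h1.le h2)
  rw [← integral_add Integrable.of_finite Integrable.of_finite]
  refine integral_mono Integrable.of_finite Integrable.of_finite fun b => ?_
  simpa using edgeIndicator_le_card_add (supp b) A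

theorem edgeIndicator_union_le (S S' : Finset (Fin n)) :
    edgeIndicator G (S ∪ S') ≤ edgeIndicator G S + edgeIndicator G S'
      + ∑ e ∈ adjPairs G univ, (if {e.1} ⊆ S then 1 else 0) * (if {e.2} ⊆ S' then 1 else 0) := by
  have hnn : ∀ e ∈ adjPairs G univ,
      (0 : ℝ) ≤ (if {e.1} ⊆ S then 1 else 0) * (if {e.2} ⊆ S' then 1 else 0) := by
    intro e _; positivity
  have hcross : ∀ u v, G.Adj u v → u ∈ S → v ∈ S' → (1 : ℝ) ≤
      ∑ e ∈ adjPairs G univ, (if {e.1} ⊆ S then 1 else 0) * (if {e.2} ⊆ S' then 1 else 0) := by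
    intro u v huv hu hv
    refine le_trans ?_ (single_le_sum hnn (a := (u, v)) ((mem_adjPairs G).2 (by simp [huv])))
    simp [hu, hv]
  by_cases h0 : ∀ u ∈ S ∪ S', ∀ w ∈ S ∪ S', ¬ G.Adj u w
  · rw [edgeIndicator_of_not_adj G h0]
    have := sum_nonneg hnn
    linarith [edgeIndicator_nonneg G S, edgeIndicator_nonneg G S']
  · push Not at h0
    obtain ⟨u, hu, w, hw, huw⟩ := h0
    have h1 := edgeIndicator_le_one G (S ∪ S')
    have h2 := sum_nonneg hnn
    have h3 := edgeIndicator_nonneg G S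
    have h4 := edgeIndicator_nonneg G S'
    rcases mem_union.1 hu with hu | hu <;> rcases mem_union.1 hw with hw | hw
    · linarith [edgeIndicator_of_adj G hu hw huw]
    · linarith [hcross u w huw hu hw]
    · linarith [hcross w u huw.symm hw hu]
    · linarith [edgeIndicator_of_adj G hu hw huw]

/-- By a union bound: an edge in the union of two random sets of rate `q` has its two ends in
the sets in one of four ways. -/
theorem pairProb_le : pairProb G q ≤ 4 * (q : ℝ) ^ 2 * edgesIn G univ := by
  have hU := hasRate_randSub n q
  have h1 := integral_edgeIndicator_le (G := G) hU univ
  have hcross : ∫ y : (Fin n → Bool) × (Fin n → Bool), ∑ e ∈ adjPairs G univ,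
      (if {e.1} ⊆ supp y.1 then (1 : ℝ) else 0) * (if {e.2} ⊆ supp y.2 then 1 else 0)
        ∂((randSub n q).prod (randSub n q)) = (adjPairs G univ).card * (q : ℝ) ^ 2 := by
    rw [integral_finsetSum _ fun _ _ => Integrable.of_finite,
      sum_congr rfl (g := fun _ => (q : ℝ) ^ 2), sum_const, nsmul_eq_mul]
    intro e _
    rw [integral_prod_mul (fun a => if {e.1} ⊆ supp a then (1 : ℝ) else 0)
      (fun a => if {e.2} ⊆ supp a then (1 : ℝ) else 0), integral_ite_one_zero,
      integral_ite_one_zero, hU, hU]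
    simp [sq]
  have hmono := integral_mono (μ := (randSub n q).prod (randSub n q))
    Integrable.of_finite Integrable.of_finite
    fun y : (Fin n → Bool) × (Fin n → Bool) =>
      edgeIndicator_union_le (G := G) (supp y.1) (supp y.2)
  rw [integral_add Integrable.of_finite Integrable.of_finite,
    integral_add Integrable.of_finite Integrable.of_finite, hcross] at hmono
  have e1 : ∫ y : (Fin n → Bool) × (Fin n → Bool), edgeIndicator G (supp y.1)
      ∂((randSub n q).prod (randSub n q)) = ∫ a, edgeIndicator G (supp a) ∂(randSub n q) := by
    rw [integral_prod _ Integrable.of_finite]; simp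
  have e2 : ∫ y : (Fin n → Bool) × (Fin n → Bool), edgeIndicator G (supp y.2)
      ∂((randSub n q).prod (randSub n q)) = ∫ a, edgeIndicator G (supp a) ∂(randSub n q) := by
    rw [integral_prod _ Integrable.of_finite]; simp
  rw [e1, e2] at hmono
  simp only [inter_univ] at h1
  unfold edgesIn pairProb
  linarith

theorem sq_le_pairProb {u v : Fin n} (h : G.Adj u v) : (q : ℝ) ^ 2 ≤ pairProb G q := by
  refine le_trans ?_ hitProb_empty_le_pairProb
  have := hasRate_randSub n q {u, v}
  rw [card_pair h.ne] at this
  rw [← this, ← integral_ite_one_zero, hitProb]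
  refine integral_mono Integrable.of_finite Integrable.of_finite fun b => ?_
  simp only [union_empty]
  split_ifs with hs
  · rw [insert_subset_iff, singleton_subset_iff] at hs
    rw [edgeIndicator_of_adj G hs.1 hs.2 h]
  · exact edgeIndicator_nonneg G _

/-- If an edge is unlikely in a random set of rate `q` and the degrees are `O(1 / q)`, then there
are few edges. -/
theorem sq_mul_edgesIn_le {A : Finset (Fin n)} (hA : ∀ v ∈ A, q * rdeg G v ≤ 2) {c : ℝ}
    (hc : hitProb G q ∅ ≤ c) (hc1 : c ≤ 1 / 10) : (q : ℝ) ^ 2 * edgesIn G A ≤ 6 * c := by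
  rcases eq_or_lt_of_le q.2.1 with h0 | h0
  · have : (0 : ℝ) ≤ c := (hitProb_nonneg _).trans hc
    rw [← h0]; simpa using this
  have hD : ∀ v ∈ A, (degIn G A v : ℝ) ≤ 2 / q := by
    intro v hv
    rw [le_div_iff₀ h0, mul_comm]
    refine le_trans ?_ (hA v hv)
    unfold rdeg
    gcongr
    exact degIn_mono G (subset_univ A) v
  set μ : ℝ := (q : ℝ) ^ 2 * (adjPairs G A).card with hμ
  have hμ0 : 0 ≤ μ := by positivity
  have h := le_integral_edgeIndicator (G := G) (hasRate_randSub n q) h0.le hD (1 / (μ + 10))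
  have he : (q : ℝ) ^ 4 * (adjPairs G A).card ^ 2 + 4 * (q : ℝ) ^ 3 * (2 / q) * (adjPairs G A).card
      + 2 * (q : ℝ) ^ 2 * (adjPairs G A).card = μ * (μ + 10) := by
    rw [hμ]; field_simp; ring
  rw [he, ← hμ] at h
  have hle : ∫ ω, edgeIndicator G (supp ω ∩ A) ∂(randSub n q) ≤ c := by
    refine le_trans (integral_mono Integrable.of_finite Integrable.of_finite fun b => ?_) hc
    exact edgeIndicator_mono G (by simp [inter_subset_left])
  have h10 : 0 < μ + 10 := by linarith
  have h2 : 2 * (1 / (μ + 10)) * μ - (1 / (μ + 10)) ^ 2 * (μ * (μ + 10)) = μ / (μ + 10) := by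
    field_simp; ring
  rw [h2] at h
  have h3 := h.trans hle
  rw [div_le_iff₀ h10] at h3
  have : (q : ℝ) ^ 2 * edgesIn G A = μ / 2 := by rw [hμ, edgesIn]; ring
  rw [this]
  nlinarith

end HitProb

/-! ### What accurate test frequencies guarantee -/

section GoodTests

variable {n : ℕ}

/-- The rate `2 ^ (-j)`. -/
noncomputable def halfPow (j : ℕ) : unitInterval :=
  ⟨(1 / 2) ^ j, by positivity, pow_le_one₀ (by norm_num) (by norm_num)⟩

theorem coe_halfPow (j : ℕ) : (halfPow j : ℝ) = (1 / 2) ^ j := rfl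

theorem halfPow_pos (j : ℕ) : (0 : ℝ) < halfPow j := by rw [coe_halfPow]; positivity

/-- The test frequencies at all rates are within `y ^ 2 / 2` of their expectations: for pairs of
test sets (with frequencies `βhat`), for single vertices, and for random sets of the same rate. -/
structure GoodTests (G : SimpleGraph (Fin n)) (y : ℝ) {J K : ℕ} (βhat : Fin (J + 1) → ℝ)
    (T : Fin (J + 1) → Fin K → Finset (Fin n)) : Prop where
  pair : ∀ j, |βhat j - pairProb G (halfPow j)| ≤ y ^ 2 / 2
  single : ∀ j v, |hitFreq G (T j) {v} - hitProb G (halfPow j) {v}| ≤ y ^ 2 / 2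
  rand : ∀ j : Fin (J + 1),
    |∫ b, hitFreq G (T j) (supp b) ∂(randSub n (halfPow j)) - pairProb G (halfPow j)| ≤ y ^ 2 / 2

/-- A rate `p`, a set `H` of heavy vertices and weights `w` suitable for estimating the number of
edges with accuracy `O(y)`: the rate is large enough compared to the number of edges, there are few
heavy vertices and few edges between light ones, light vertices have degree `O(1 / p)`, and the
weights of the heavy ones approximate their degrees. -/
structure GoodSplit (G : SimpleGraph (Fin n)) (y p : ℝ) (H : Finset (Fin n)) (w : Fin n → ℝ) :
    Prop where
  pos : 0 < p
  edges : y ^ 2 ≤ 32 * p ^ 2 * edgesIn G univ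
  card_heavy : p * H.card ≤ 5 * y ^ 2
  light_deg : ∀ v ∈ Hᶜ, p * rdeg G v ≤ 2
  light_edges : p ^ 2 * edgesIn G Hᶜ ≤ 9 * y ^ 2
  weight : ∀ v ∈ H, |w v - rdeg G v| ≤ 3 * y * rdeg G v

variable {G : SimpleGraph (Fin n)} {x J K : ℕ} {βhat : Fin (J + 1) → ℝ}
  {T : Fin (J + 1) → Fin K → Finset (Fin n)} {y : ℝ}

theorem rdeg_le (v : Fin n) : rdeg G v ≤ n := by
  unfold rdeg degIn
  exact_mod_cast (card_le_card (subset_univ _)).trans (card_fin n).le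

theorem edgesIn_le : edgesIn G univ ≤ (n : ℝ) ^ 2 / 2 := by
  unfold edgesIn
  have h : (adjPairs G univ).card ≤ n ^ 2 :=
    (card_le_univ _).trans (by simp [sq])
  have : ((adjPairs G univ).card : ℝ) ≤ (n : ℝ) ^ 2 := by exact_mod_cast h
  linarith

theorem edgesIn_mono {A B : Finset (Fin n)} (h : A ⊆ B) : edgesIn G A ≤ edgesIn G B := by
  unfold edgesIn
  gcongr
  intro e he
  rw [mem_adjPairs] at he ⊢
  exact ⟨h he.1, h he.2.1, he.2.2⟩

theorem exists_adj_of_edgesIn_pos (h : 0 < edgesIn G univ) : ∃ u v, G.Adj u v := by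
  have : (adjPairs G univ).Nonempty := by
    by_contra h'
    rw [not_nonempty_iff_eq_empty] at h'
    simp [edgesIn, h'] at h
  obtain ⟨e, he⟩ := this
  exact ⟨e.1, e.2, ((mem_adjPairs G).1 he).2.2⟩

/-- The first rate at which the pair frequency is small: the rate before it certifies a lower bound
on the number of edges. -/
theorem GoodTests.first_rate (h : GoodTests G y βhat T) (hy0 : 0 < y) (hy : y ≤ 1 / 64)
    (hm : 0 < edgesIn G univ) (hJ : 4 * (n : ℝ) ^ 2 * (halfPow J : ℝ) ^ 2 ≤ y ^ 2) :
    pairProb G (halfPow (leastIdx fun j => βhat j ≤ y ^ 2)) ≤ 3 / 2 * y ^ 2 ∧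
      y ^ 2 ≤ 32 * (halfPow (leastIdx fun j => βhat j ≤ y ^ 2) : ℝ) ^ 2 * edgesIn G univ := by
  have hex : ∃ j, βhat j ≤ y ^ 2 := by
    refine ⟨Fin.last J, ?_⟩
    have h1 := (abs_le.1 (h.pair (Fin.last J))).2
    rw [Fin.val_last] at h1
    have h2 := pairProb_le (G := G) (q := halfPow J)
    have h3 : 4 * (halfPow J : ℝ) ^ 2 * edgesIn G univ
        ≤ 4 * (halfPow J : ℝ) ^ 2 * ((n : ℝ) ^ 2 / 2) := by
      gcongr; exact edgesIn_le
    linarith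
  obtain ⟨h1, h2⟩ := leastIdx_spec hex
  set j₀ := leastIdx fun j => βhat j ≤ y ^ 2 with hj₀
  refine ⟨by linarith [(abs_le.1 (h.pair j₀)).1], ?_⟩
  have hpos : (j₀ : ℕ) ≠ 0 := by
    intro h0
    obtain ⟨u, v, huv⟩ := exists_adj_of_edgesIn_pos hm
    have h3 := sq_le_pairProb (q := halfPow 0) huv
    have h4 := (abs_le.1 (h.pair j₀)).1
    rw [h0] at h4
    simp only [coe_halfPow, pow_zero, one_pow] at h3
    nlinarith
  obtain ⟨k, hk⟩ := Nat.exists_eq_succ_of_ne_zero hpos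
  have hkJ : k < J + 1 := by have := j₀.2; omega
  have h3 := h2 ⟨k, hkJ⟩ (by rw [Fin.lt_def]; simp [hk])
  have h4 := (abs_le.1 (h.pair ⟨k, hkJ⟩)).2
  have h5 := pairProb_le (G := G) (q := halfPow k)
  simp only at h4
  have h6 : (halfPow k : ℝ) = 2 * halfPow j₀ := by
    rw [coe_halfPow, coe_halfPow, hk, pow_succ]; ring
  rw [h6] at h5
  push Not at h3
  nlinarith

/-- A random set rarely behaves like a heavy vertex. -/
theorem GoodTests.real_heavy_le (h : GoodTests G y βhat T) (hy : y ≤ 1 / 64) (hy0 : 0 < y)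
    {j : Fin (J + 1)} (hj : pairProb G (halfPow j) ≤ 3 / 2 * y ^ 2) :
    (randSub n (halfPow j)).real {b | 1 / 2 ≤ hitFreq G (T j) (supp b)} ≤ 1 / 2 := by
  have h1 := mul_meas_ge_le_integral_of_nonneg (μ := randSub n (halfPow j))
    (f := fun b => hitFreq G (T j) (supp b))
    (Eventually.of_forall fun b => hitFreq_nonneg G _ _) Integrable.of_finite (1 / 2)
  have h2 := (abs_le.1 (h.rand j)).2
  nlinarith

/-- If a frequency `F` is within `y ^ 2 / 2` of the probability `P` of hitting a neighbour of a
vertex with `z` expected neighbours, and `z` is of order `y`, then `F` is `z` up to a factor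
`1 + O(y)`. -/
theorem abs_freq_sub_le {y z F P : ℝ} (hy0 : 0 < y) (hy : y ≤ 1 / 64) (hz : 48 / 100 * y ≤ z)
    (hF : |F - P| ≤ y ^ 2 / 2) (hup : P ≤ z + 47 * y ^ 2 * z) (hlow : z / (1 + z) ≤ P)
    (hFy : F ≤ y) : |F - z| ≤ 3 * y * z := by
  have hfr := abs_le.1 hF
  have hz0 : 0 < z := by nlinarith
  have hzup : z ≤ 11 / 10 * y := by
    have h1 : z / (1 + z) ≤ y + y ^ 2 / 2 := by linarith [hfr.1]
    rw [div_le_iff₀ (by positivity)] at h1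
    have h2 : y + y ^ 2 / 2 ≤ 129 / 128 * y := by nlinarith
    have h3 : (y + y ^ 2 / 2) * (1 + z) ≤ 129 / 128 * y * (1 + z) := by gcongr
    have h4 : y * z ≤ 1 / 64 * z := by gcongr
    nlinarith
  have hlow2 : z - z ^ 2 ≤ P := by
    refine le_trans ?_ hlow
    rw [le_div_iff₀ (by positivity)]
    have := pow_pos hz0 3
    linarith [show (z - z ^ 2) * (1 + z) = z - z ^ 3 by ring]
  have h1 : y ^ 2 / 2 ≤ 11 / 10 * y * z := by
    have := mul_le_mul_of_nonneg_left hz hy0.le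
    nlinarith
  have h2 : z ^ 2 ≤ 11 / 10 * y * z := by
    rw [sq]; gcongr
  have h3 : 47 * y ^ 2 * z ≤ 3 / 4 * y * z := by
    have : 47 * y ^ 2 ≤ 3 / 4 * y := by nlinarith
    gcongr
  have h4 : 0 < y * z := by positivity
  rw [abs_le]
  constructor <;> linarith [hfr.1, hfr.2]

/-- The degree estimates of heavy vertices are accurate. -/
theorem GoodTests.abs_degEst_sub_le (h : GoodTests G y βhat T) (hx : 64 ≤ x) (hyx : y = 1 / x)
    (hJ' : 4 * (n : ℝ) * (halfPow J : ℝ) ≤ y) {j₀ : Fin (J + 1)}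
    (hβ : pairProb G (halfPow j₀) ≤ 3 / 2 * y ^ 2)
    (hcard : (halfPow j₀ : ℝ) * (heavySet G (T j₀)).card ≤ 5 * y ^ 2)
    (hle : (halfPow j₀ : ℝ) ^ 2 * edgesIn G (heavySet G (T j₀))ᶜ ≤ 9 * y ^ 2) {v : Fin n}
    (hv : v ∈ heavySet G (T j₀)) :
    |degEst G x T j₀ v - rdeg G v| ≤ 3 * y * rdeg G v := by
  have hxR : (64 : ℝ) ≤ x := by exact_mod_cast hx
  have hy0 : 0 < y := by rw [hyx]; positivity
  have hy : y ≤ 1 / 64 := by rw [hyx]; gcongr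
  set p : unitInterval := halfPow j₀ with hp
  set H := heavySet G (T j₀) with hH
  have hp0 : (0 : ℝ) < p := halfPow_pos _
  have hα : hitProb G p ∅ ≤ 3 / 2 * y ^ 2 := hitProb_empty_le_pairProb.trans hβ
  have hy2 : y ^ 2 ≤ 1 / 4096 := by nlinarith
  have hsingle := fun j => h.single j v
  have hv' : 1 / 2 ≤ hitFreq G (T j₀) {v} := by simpa [hH, heavySet] using hv
  have hd0 := rdeg_nonneg G v
  -- the noise from edges not at `v` is small compared to the expected number of neighbours
  have hpd : 3 / 10 ≤ p * rdeg G v := by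
    linarith [hitProb_le (G := G) (q := p) v, (abs_le.1 (hsingle j₀)).2]
  have hnoise : ∀ q : unitInterval, (q : ℝ) ≤ p →
      hitProb G q ∅ ≤ 47 * y ^ 2 * (q * rdeg G v) := by
    intro q hq
    have h1 := hitProb_empty_le (G := G) (q := q) H
    obtain ⟨s, hs⟩ : ∃ s : ℝ, s = q / p := ⟨_, rfl⟩
    have hqs : (q : ℝ) = s * p := by rw [hs, div_mul_cancel₀ _ hp0.ne']
    have hs0 : 0 ≤ s := by rw [hs]; exact div_nonneg q.2.1 hp0.le
    have hs1 : s ≤ 1 := by rw [hs]; exact div_le_one_of_le₀ hq hp0.le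
    have h2 : hitProb G q ∅ ≤ s * (p * H.card) + s ^ 2 * ((p : ℝ) ^ 2 * edgesIn G Hᶜ) := by
      refine h1.trans (le_of_eq ?_); rw [hqs]; ring
    have h3 : s * (p * H.card) ≤ s * (5 * y ^ 2) := by gcongr
    have h4 : s ^ 2 * ((p : ℝ) ^ 2 * edgesIn G Hᶜ) ≤ s * (9 * y ^ 2) := by
      have : s ^ 2 ≤ s := by nlinarith
      have h0 : 0 ≤ (p : ℝ) ^ 2 * edgesIn G Hᶜ :=
        mul_nonneg (by positivity) (edgesIn_nonneg G _)
      gcongr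
    have h5 : s * y ^ 2 * (3 / 10) ≤ s * y ^ 2 * (p * rdeg G v) := by gcongr
    rw [hqs]
    have h6 : 0 ≤ s * y ^ 2 := by positivity
    nlinarith
  have hex : ∃ j, j₀ ≤ j ∧ hitFreq G (T j) {v} ≤ 1 / x := by
    refine ⟨Fin.last J, Fin.le_last _, ?_⟩
    have hq : (halfPow J : ℝ) ≤ p := by
      rw [hp, coe_halfPow, coe_halfPow]
      exact pow_le_pow_of_le_one (by norm_num) (by norm_num) (Nat.lt_succ_iff.1 j₀.2)
    have h1 := hnoise _ hq
    have h2 := hitProb_le (G := G) (q := halfPow J) v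
    have h3 := (abs_le.1 (hsingle (Fin.last J))).2
    rw [Fin.val_last] at h3
    have h4 : (halfPow J : ℝ) * rdeg G v ≤ halfPow J * n :=
      mul_le_mul_of_nonneg_left (rdeg_le v) (halfPow_pos J).le
    rw [← hyx]
    have h5 : (halfPow J : ℝ) * rdeg G v ≤ y / 4 := by linarith
    nlinarith
  obtain ⟨⟨hj1, hj2⟩, hj3⟩ := leastIdx_spec hex
  unfold degEst degEstimate
  simp only
  set j := leastIdx fun j => j₀ ≤ j ∧ hitFreq G (T j) {v} ≤ 1 / x with hj
  set q : unitInterval := halfPow j with hq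
  rw [← hyx] at hj2
  have hq0 : (0 : ℝ) < q := halfPow_pos _
  have hqp : (q : ℝ) ≤ p := by
    rw [hp, hq, coe_halfPow, coe_halfPow]
    exact pow_le_pow_of_le_one (by norm_num) (by norm_num) hj1
  have hne : j₀ ≠ j := by
    intro he
    rw [← he] at hj2
    linarith
  have hlt : j₀ < j := lt_of_le_of_ne hj1 hne
  obtain ⟨k, hk⟩ := Nat.exists_eq_succ_of_ne_zero (n := (j : ℕ)) (by rw [Fin.lt_def] at hlt; omega)
  have hkJ : k < J + 1 := by have := j.2; omega
  have hk0 : j₀ ≤ ⟨k, hkJ⟩ := by rw [Fin.lt_def] at hlt; rw [Fin.le_def]; simp only; omega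
  have hk1 : y < hitFreq G (T ⟨k, hkJ⟩) {v} := by
    have := hj3 ⟨k, hkJ⟩ (by rw [Fin.lt_def]; simp [hk])
    rw [hyx]
    by_contra hcon
    exact this ⟨hk0, not_lt.1 hcon⟩
  have hkq : (halfPow k : ℝ) = 2 * q := by
    rw [hq, coe_halfPow, coe_halfPow, hk, pow_succ]; ring
  have hkp : (halfPow k : ℝ) ≤ p := by
    rw [hp, coe_halfPow, coe_halfPow]
    exact pow_le_pow_of_le_one (by norm_num) (by norm_num) hk0
  obtain ⟨z, hz⟩ : ∃ z : ℝ, z = q * rdeg G v := ⟨_, rfl⟩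
  have hz0 : 0 ≤ z := by rw [hz]; positivity
  have hy3 : 47 * y ^ 2 ≤ 3 / 4 * y := by nlinarith
  -- at twice the rate the frequency exceeds `y`, so `z` is not much smaller than `y / 2`
  have hzlow : 48 / 100 * y ≤ z := by
    have h1 := hnoise _ hkp
    have h2 := hitProb_le (G := G) (q := halfPow k) v
    have h3 := (abs_le.1 (hsingle ⟨k, hkJ⟩)).2
    simp only at h3
    rw [hkq] at h1 h2
    have h4 : 2 * (q : ℝ) * rdeg G v = 2 * z := by rw [hz]; ring
    rw [h4] at h1 h2
    nlinarith
  have hfr := abs_le.1 (hsingle j)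
  have hup : hitProb G q {v} ≤ z + 47 * y ^ 2 * z := by
    have := hnoise q hqp
    rw [hz]; linarith [hitProb_le (G := G) (q := q) v]
  have hlow : z / (1 + z) ≤ hitProb G q {v} := by
    have h1 := div_le_one_sub_pow q.2.1 q.2.2 (degIn G univ v)
    have h2 : z / (1 + z) ≤ 1 - (1 - q : ℝ) ^ degIn G univ v := by
      rw [hz, mul_comm]; exact h1
    exact h2.trans (one_sub_pow_le_hitProb v)
  have hmain : |hitFreq G (T j) {v} - z| ≤ 3 * y * z :=
    abs_freq_sub_le hy0 hy hzlow (hsingle j) hup hlow hj2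
  have hq2 : (2 : ℝ) ^ (j : ℕ) = 1 / q := by rw [hq, coe_halfPow]; simp
  have hdz : rdeg G v = z * (1 / q) := by rw [hz]; field_simp
  rw [hq2, hdz, ← sub_mul, abs_mul, abs_of_pos (by positivity : (0 : ℝ) < 1 / q), ← mul_assoc]
  gcongr

/-- Accurate test frequencies yield a good split at the first rate at which the pair frequency is
small. Heavy vertices are few because a random set that meets them would often have an edge
together with another random set. -/
theorem GoodTests.split (h : GoodTests G y βhat T) (hx : 64 ≤ x) (hyx : y = 1 / x)
    (hm : 0 < edgesIn G univ)
    (hJ : 4 * (n : ℝ) ^ 2 * (halfPow J : ℝ) ^ 2 ≤ y ^ 2)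
    (hJ' : 4 * (n : ℝ) * (halfPow J : ℝ) ≤ y)
    {j₀ : Fin (J + 1)} (hj₀ : j₀ = leastIdx fun j => βhat j ≤ y ^ 2) :
    GoodSplit G y (halfPow j₀) (heavySet G (T j₀)) (degEst G x T j₀) := by
  have hxR : (64 : ℝ) ≤ x := by exact_mod_cast hx
  have hy0 : 0 < y := by rw [hyx]; positivity
  have hy : y ≤ 1 / 64 := by rw [hyx]; gcongr
  obtain ⟨hβ, hedges⟩ := h.first_rate hy0 hy hm hJ
  rw [← hj₀] at hβ hedges
  set p : unitInterval := halfPow j₀ with hp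
  set H := heavySet G (T j₀) with hH
  have hp0 : (0 : ℝ) < p := halfPow_pos _
  have hheavy : ∀ v, v ∈ H ↔ 1 / 2 ≤ hitFreq G (T j₀) {v} := by simp [hH, heavySet]
  have hα : hitProb G p ∅ ≤ 3 / 2 * y ^ 2 := hitProb_empty_le_pairProb.trans hβ
  have hy2 : y ^ 2 ≤ 1 / 4096 := by nlinarith
  have hH2 : (2 / 5 : ℝ) * (1 - (1 - p : ℝ) ^ H.card) ≤ 3 / 2 * y ^ 2 := by
    refine (mul_one_sub_pow_le_pairProb fun v hv => ?_).trans hβ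
    linarith [(hheavy v).1 hv, (abs_le.1 (h.single j₀ v)).2]
  have hcard : (p : ℝ) * H.card ≤ 5 * y ^ 2 := by
    have h1 := div_le_one_sub_pow p.2.1 p.2.2 H.card
    have h2 : (H.card * p : ℝ) / (1 + H.card * p) ≤ 15 / 4 * y ^ 2 := by linarith
    have h3 : (0 : ℝ) ≤ H.card * p := by positivity
    rw [div_le_iff₀ (by positivity)] at h2
    nlinarith
  have hlight : ∀ v ∈ Hᶜ, p * rdeg G v ≤ 2 := by
    intro v hv
    rw [mem_compl, hheavy, not_le] at hv
    have h1 := (abs_le.1 (h.single j₀ v)).1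
    have h2 := one_sub_pow_le_hitProb (G := G) (q := p) v
    have h3 := div_le_one_sub_pow p.2.1 p.2.2 (degIn G univ v)
    have h4 : rdeg G v * p / (1 + rdeg G v * p) ≤ 51 / 100 := by
      have : rdeg G v * p / (1 + rdeg G v * p) ≤ 1 - (1 - p : ℝ) ^ degIn G univ v := h3
      linarith
    have h5 : 0 ≤ rdeg G v * p := mul_nonneg (rdeg_nonneg G v) p.2.1
    rw [div_le_iff₀ (by positivity)] at h4
    linarith
  have hle : (p : ℝ) ^ 2 * edgesIn G Hᶜ ≤ 9 * y ^ 2 :=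
    (sq_mul_edgesIn_le hlight hα (by linarith)).trans (by linarith)
  exact ⟨hp0, hedges, hcard, hlight, hle, fun v hv =>
    h.abs_degEst_sub_le hx hyx hJ' hβ hcard hle hv⟩

end GoodTests

/-! ### Groups of random vertices -/

section Groups

variable {n : ℕ} {G : SimpleGraph (Fin n)}

theorem descentCost_nonneg (K : ℕ) (heavy : Finset (Fin n) → Prop) (R : Finset (Fin n))
    (ℓ a : ℕ) : 0 ≤ descentCost K heavy R ℓ a := by
  induction ℓ generalizing a with
  | zero => exact le_rfl
  | succ ℓ ih =>
    simp only [descentCost]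
    split_ifs
    · have h1 := ih (2 * a)
      have h2 := ih (2 * a + 1)
      positivity
    · exact le_rfl

/-- The expected cost of the binary search. With `N` the probability that a node is not heavy,
`-log N` is superadditive under splitting the node, because the two parts of the random set are
independent; so the expected number of heavy nodes on each level is at most `-log N` at the root. -/
theorem integral_descentCost_le (q : unitInterval) (K : ℕ) {heavy : Finset (Fin n) → Prop}
    (hmono : ∀ U V, U ⊆ V → heavy U → heavy V) (ℓ a : ℕ)
    (hN : 0 < (randSub n q).real {b | ¬ heavy (supp b ∩ block n ℓ a)}) :
    ∫ b, descentCost K heavy (supp b) ℓ a ∂(randSub n q)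
      ≤ 2 * K * ℓ * -Real.log ((randSub n q).real {b | ¬ heavy (supp b ∩ block n ℓ a)}) := by
  classical
  induction ℓ generalizing a with
  | zero => simp [descentCost]
  | succ ℓ ih =>
    set N := (randSub n q).real {b | ¬ heavy (supp b ∩ block n (ℓ + 1) a)} with hNdef
    set N₁ := (randSub n q).real {b | ¬ heavy (supp b ∩ block n ℓ (2 * a))} with hN₁
    set N₂ := (randSub n q).real {b | ¬ heavy (supp b ∩ block n ℓ (2 * a + 1))} with hN₂
    have hNle : N ≤ N₁ * N₂ := by
      rw [hN₁, hN₂, ← randSub_real_and q (disjoint_block n ℓ (by omega))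
        (fun U => ¬ heavy U) (fun U => ¬ heavy U)]
      refine measureReal_mono fun b hb => ?_
      rw [Set.mem_ofPred_eq, block_succ] at hb
      rw [Set.mem_ofPred_eq]
      exact ⟨fun h => hb (hmono _ _ (inter_subset_inter_left subset_union_left) h),
        fun h => hb (hmono _ _ (inter_subset_inter_left subset_union_right) h)⟩
    have hN₁0 : 0 ≤ N₁ := measureReal_nonneg
    have hN₂0 : 0 ≤ N₂ := measureReal_nonneg
    have hN₁p : 0 < N₁ := by
      rcases hN₁0.eq_or_lt with h | h
      · rw [← h, zero_mul] at hNle; linarith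
      · exact h
    have hN₂p : 0 < N₂ := by
      rcases hN₂0.eq_or_lt with h | h
      · rw [← h, mul_zero] at hNle; linarith
      · exact h
    have hlog : Real.log N ≤ Real.log N₁ + Real.log N₂ := by
      rw [← Real.log_mul hN₁p.ne' hN₂p.ne']
      exact Real.log_le_log hN hNle
    have hpt : ∀ b : Fin n → Bool, descentCost K heavy (supp b) (ℓ + 1) a
        ≤ 2 * K * (1 - if ¬ heavy (supp b ∩ block n (ℓ + 1) a) then 1 else 0)
          + descentCost K heavy (supp b) ℓ (2 * a)
          + descentCost K heavy (supp b) ℓ (2 * a + 1) := by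
      intro b
      have h1 := descentCost_nonneg K heavy (supp b) ℓ (2 * a)
      have h2 := descentCost_nonneg K heavy (supp b) ℓ (2 * a + 1)
      simp only [descentCost]
      split_ifs <;> linarith
    have hint := integral_mono (μ := randSub n q) Integrable.of_finite Integrable.of_finite hpt
    rw [integral_add Integrable.of_finite Integrable.of_finite,
      integral_add Integrable.of_finite Integrable.of_finite, integral_const_mul,
      integral_sub Integrable.of_finite Integrable.of_finite, integral_ite_one_zero,
      integral_const, probReal_univ, one_smul, ← hNdef] at hint
    have hK : (0 : ℝ) ≤ K := Nat.cast_nonneg K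
    have h1 : (K : ℝ) * (1 - N) ≤ K * -Real.log N := by
      have := Real.log_le_sub_one_of_pos hN
      gcongr; linarith
    have h2 : 2 * K * ℓ * (-Real.log N₁ + -Real.log N₂) ≤ 2 * K * ℓ * -Real.log N := by
      gcongr; linarith
    push_cast
    linarith [ih _ hN₁p, ih _ hN₂p]

/-- If a random set is not heavy with probability at least `1 / 2`, then `-log N ≤ log 2 ≤ 1` at the
root of the binary search. -/
theorem integral_descentCost_univ_le {x : ℕ} (hn : n ≤ 2 ^ x) (q : unitInterval) (K : ℕ)
    {heavy : Finset (Fin n) → Prop} (hmono : ∀ U V, U ⊆ V → heavy U → heavy V)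
    (hheavy : (randSub n q).real {b | heavy (supp b)} ≤ 1 / 2) :
    ∫ b, descentCost K heavy (supp b) x 0 ∂(randSub n q) ≤ 2 * K * x := by
  have hN : 1 / 2 ≤ (randSub n q).real {b | ¬ heavy (supp b ∩ block n x 0)} := by
    simp only [block_eq_univ hn, inter_univ]
    have := probReal_compl_eq_one_sub (μ := randSub n q)
      (s := {b | heavy (supp b)}) (Set.toFinite _).measurableSet
    have h2 : {b : Fin n → Bool | ¬ heavy (supp b)} = {b | heavy (supp b)}ᶜ := rfl
    rw [h2]; linarith
  refine (integral_descentCost_le q K hmono x 0 (by linarith)).trans ?_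
  refine mul_le_of_le_one_right (by positivity) ?_
  have h1 := Real.log_le_log (by norm_num) hN
  have h2 : Real.log (1 / 2) = -Real.log 2 := by simp
  linarith [Real.log_two_lt_d9]

section Moments

variable {Ω : Type*} [MeasurableSpace Ω] [Finite Ω] [MeasurableSingletonClass Ω] {μ : Measure Ω}
  [IsProbabilityMeasure μ] {U : Ω → Finset (Fin n)} {q : ℝ}

theorem sum_inter_eq (S H : Finset (Fin n)) (w : Fin n → ℝ) :
    ∑ v ∈ S ∩ H, w v = ∑ v ∈ H, w v * if ({v} : Finset (Fin n)) ⊆ S then 1 else 0 := by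
  rw [inter_comm, ← filter_mem_eq_inter, sum_filter]
  simp only [singleton_subset_iff, mul_ite, mul_one, mul_zero]

theorem integral_sum_inter (hU : HasRate μ U q) (H : Finset (Fin n)) (w : Fin n → ℝ) :
    ∫ ω, ∑ v ∈ U ω ∩ H, w v ∂μ = q * ∑ v ∈ H, w v := by
  simp only [sum_inter_eq]
  rw [integral_finsetSum _ fun _ _ => Integrable.of_finite, mul_sum]
  refine sum_congr rfl fun v _ => ?_
  rw [integral_const_mul, integral_ite_one_zero, hU]
  simp [mul_comm]

/-- The variance of the total weight of the members of `H` in a random set. -/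
theorem integral_sum_inter_sq_sub_le (hU : HasRate μ U q) (hq : 0 ≤ q) {H : Finset (Fin n)}
    {w : Fin n → ℝ} (hw : ∀ v ∈ H, 0 ≤ w v) {D : ℝ} (hD : ∀ v ∈ H, w v ≤ D) :
    ∫ ω, (∑ v ∈ U ω ∩ H, w v) ^ 2 ∂μ - (∫ ω, ∑ v ∈ U ω ∩ H, w v ∂μ) ^ 2
      ≤ q * (D * ∑ v ∈ H, w v) := by
  rw [integral_sum_inter hU]
  have h : ∀ ω, (∑ v ∈ U ω ∩ H, w v) ^ 2 = ∑ v ∈ H, ∑ u ∈ H,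
      w v * w u * if ({v, u} : Finset (Fin n)) ⊆ U ω then 1 else 0 := by
    intro ω
    rw [sum_inter_eq, sq, sum_mul_sum]
    refine sum_congr rfl fun v _ => sum_congr rfl fun u _ => ?_
    simp only [insert_subset_iff, singleton_subset_iff]
    split_ifs <;> first | (simp; done) | (exfalso; tauto)
  simp only [h]
  rw [integral_finsetSum _ fun _ _ => Integrable.of_finite]
  have hle : ∀ v ∈ H, ∫ ω, ∑ u ∈ H, w v * w u *
      (if ({v, u} : Finset (Fin n)) ⊆ U ω then 1 else 0) ∂μ
      ≤ q ^ 2 * w v * ∑ u ∈ H, w u + q * (D * w v) := by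
    intro v hv
    rw [integral_finsetSum _ fun _ _ => Integrable.of_finite]
    calc _ ≤ ∑ u ∈ H, (q ^ 2 * w v * w u + if v = u then q * (D * w v) else 0) := by
          refine sum_le_sum fun u hu => ?_
          rw [integral_const_mul, integral_ite_one_zero, hU]
          by_cases hvu : v = u
          · subst hvu
            have h1 := mul_le_mul_of_nonneg_left (hD v hv) (mul_nonneg hq (hw v hv))
            have h2 : 0 ≤ q ^ 2 * w v * w v := by have := hw v hv; positivity
            simp only [insert_eq_of_mem (mem_singleton_self v), card_singleton, pow_one, if_true]
            linarith
          · rw [card_pair hvu, if_neg hvu]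
            linarith
      _ = _ := by rw [sum_add_distrib, ← mul_sum, sum_ite_eq, if_pos hv]
  have := sum_le_sum hle
  rw [sum_add_distrib, ← sum_mul, ← mul_sum, ← mul_sum, ← mul_sum] at this
  linarith

/-- A sparse random set contains an edge of `A` with probability close to the expected number of
edges in it. -/
theorem abs_integral_edgeIndicator_sub_le {p γ : ℝ} (hp : 0 < p) (hγ0 : 0 ≤ γ) (hγ1 : γ ≤ 1)
    (hU : HasRate μ U (p * γ)) {A : Finset (Fin n)}
    (hA : ∀ v ∈ A, p * degIn G A v ≤ 2) (he : p ^ 2 * edgesIn G A ≤ 1) :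
    |∫ ω, edgeIndicator G (U ω ∩ A) ∂μ - (p * γ) ^ 2 * edgesIn G A|
      ≤ 5 * γ * (p * γ) ^ 2 * edgesIn G A := by
  have hD : ∀ v ∈ A, (degIn G A v : ℝ) ≤ 2 / p := by
    intro v hv
    rw [le_div_iff₀ hp, mul_comm]
    exact hA v hv
  have h1 := integral_edgeIndicator_le (G := G) hU A
  have h2 := le_integral_edgeIndicator (G := G) hU (by positivity) hD (1 / 2)
  have hN : ((adjPairs G A).card : ℝ) = 2 * edgesIn G A := by unfold edgesIn; ring
  have he0 := edgesIn_nonneg G A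
  rw [hN] at h1 h2
  have h3 : (p * γ) ^ 3 * (2 / p) = 2 * γ * (p * γ) ^ 2 := by field_simp
  have h4 : (p * γ) ^ 4 * edgesIn G A ^ 2 ≤ γ * ((p * γ) ^ 2 * edgesIn G A) := by
    have h5 : (p * γ) ^ 4 * edgesIn G A ^ 2
        = (γ * (p ^ 2 * edgesIn G A)) * (γ * ((p * γ) ^ 2 * edgesIn G A)) := by ring
    rw [h5]
    refine mul_le_of_le_one_left (by positivity) ?_
    exact mul_le_one₀ hγ1 (by positivity) he
  have h6 : 4 * (p * γ) ^ 3 * (2 / p) * (2 * edgesIn G A)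
      = 16 * γ * ((p * γ) ^ 2 * edgesIn G A) := by
    linear_combination 8 * edgesIn G A * h3
  have h7 : 0 ≤ γ * ((p * γ) ^ 2 * edgesIn G A) := by positivity
  rw [abs_le]
  constructor
  · nlinarith
  · nlinarith

end Moments

theorem degIn_add_compl (A : Finset (Fin n)) (v : Fin n) :
    (degIn G A v : ℝ) + degIn G Aᶜ v = rdeg G v := by
  classical
  unfold rdeg degIn
  rw [← Nat.cast_add, ← card_union_of_disjoint, ← filter_union, union_compl]
  exact disjoint_filter_filter disjoint_compl_right

theorem sum_degIn_comm (A B : Finset (Fin n)) :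
    ∑ u ∈ A, (degIn G B u : ℝ) = ∑ v ∈ B, (degIn G A v : ℝ) := by
  classical
  simp only [degIn, card_filter, Nat.cast_sum]
  rw [sum_comm]
  simp only [G.adj_comm]

/-- Every edge is counted by the degrees of the vertices of `H`, except the edges outside of `H`,
and the edges inside `H` are counted twice. -/
theorem edgesIn_univ_eq (H : Finset (Fin n)) :
    edgesIn G univ = ∑ v ∈ H, rdeg G v + (edgesIn G Hᶜ - edgesIn G H) := by
  have h1 : ∑ v, rdeg G v = ∑ v ∈ H, rdeg G v + ∑ v ∈ Hᶜ, rdeg G v :=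
    (sum_add_sum_compl H _).symm
  have h2 : ∑ v ∈ Hᶜ, rdeg G v = ∑ v ∈ Hᶜ, (degIn G H v : ℝ) + ∑ v ∈ Hᶜ, (degIn G Hᶜ v : ℝ) := by
    rw [← sum_add_distrib]; exact sum_congr rfl fun v _ => (degIn_add_compl H v).symm
  have h3 : ∑ v ∈ H, rdeg G v = ∑ v ∈ H, (degIn G H v : ℝ) + ∑ v ∈ H, (degIn G Hᶜ v : ℝ) := by
    rw [← sum_add_distrib]; exact sum_congr rfl fun v _ => (degIn_add_compl H v).symm
  have h4 := sum_degIn_comm (G := G) Hᶜ H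
  have h5 : ∑ v, rdeg G v = ∑ v, (degIn G univ v : ℝ) := rfl
  unfold edgesIn
  rw [card_adjPairs, card_adjPairs, card_adjPairs]
  linarith

theorem sum_rdeg_le (H : Finset (Fin n)) : ∑ v ∈ H, rdeg G v ≤ 2 * edgesIn G univ := by
  have h : 2 * edgesIn G univ = ∑ v, rdeg G v := by
    unfold edgesIn rdeg; rw [card_adjPairs]; ring
  rw [h]
  exact sum_le_sum_of_subset_of_nonneg (subset_univ H) fun v _ _ => rdeg_nonneg G v

theorem rdeg_le_two_mul (v : Fin n) : rdeg G v ≤ 2 * edgesIn G univ := by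
  simpa using sum_rdeg_le (G := G) {v}

namespace GoodSplit

variable {y p : ℝ} {H : Finset (Fin n)} {w : Fin n → ℝ}

theorem weight_le (h : GoodSplit G y p H w) (hy : y ≤ 1 / 64) {v : Fin n} (hv : v ∈ H) :
    w v ≤ 3 / 2 * rdeg G v := by
  nlinarith [(abs_le.1 (h.weight v hv)).2, rdeg_nonneg G v]

theorem abs_sum_weight_sub_le (h : GoodSplit G y p H w) (hy : 0 ≤ y) :
    |∑ v ∈ H, w v - ∑ v ∈ H, rdeg G v| ≤ 6 * y * edgesIn G univ := by
  rw [← sum_sub_distrib]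
  refine (abs_sum_le_sum_abs _ _).trans ((sum_le_sum h.weight).trans ?_)
  rw [← mul_sum]
  nlinarith [sum_rdeg_le (G := G) H]

theorem sum_weight_le (h : GoodSplit G y p H w) (hy : y ≤ 1 / 64) :
    ∑ v ∈ H, w v ≤ 3 * edgesIn G univ := by
  refine (sum_le_sum fun v hv => h.weight_le hy hv).trans ?_
  rw [← mul_sum]
  linarith [sum_rdeg_le (G := G) H]

/-- The number of edges is of the order of the total weight of the heavy vertices, up to
`1 / p ^ 2`. This is why a stage is stopped on account of `W + T / p`, for `T` groups of total
weight `W`. -/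
theorem edgesIn_le_weight (h : GoodSplit G y p H w) (hy : y ≤ 1 / 64) (hy0 : 0 ≤ y) :
    edgesIn G univ ≤ 2 * ∑ v ∈ H, w v + 1 / p ^ 2 := by
  have hp := h.pos
  have h1 : ∑ v ∈ H, rdeg G v ≤ 2 * ∑ v ∈ H, w v := by
    rw [mul_sum]
    refine sum_le_sum fun v hv => ?_
    nlinarith [(abs_le.1 (h.weight v hv)).1, rdeg_nonneg G v]
  have h2 : edgesIn G Hᶜ ≤ 1 / p ^ 2 := by
    rw [le_div_iff₀ (by positivity)]
    nlinarith [h.light_edges]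
  linarith [edgesIn_univ_eq (G := G) H, edgesIn_nonneg G H]

theorem edgesIn_pos (h : GoodSplit G y p H w) (hy : 0 < y) : 0 < edgesIn G univ := by
  have h1 := h.edges
  have hp := h.pos
  by_contra hcon
  have : edgesIn G univ = 0 := le_antisymm (not_lt.1 hcon) (edgesIn_nonneg G univ)
  rw [this, mul_zero] at h1
  nlinarith [sq_nonneg y, pow_pos hy 2]

/-- The difference of the indicators of an edge among light and among heavy vertices in a sparse
random set, in expectation. -/
theorem abs_integral_lightMinusHeavy_sub_le (h : GoodSplit G y p H w) (hy : y ≤ 1 / 64)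
    (hy0 : 0 ≤ y) {Ω : Type*} [MeasurableSpace Ω] [Finite Ω] [MeasurableSingletonClass Ω]
    {μ : Measure Ω} [IsProbabilityMeasure μ] {U : Ω → Finset (Fin n)}
    (hU : HasRate μ U (p * y)) :
    |∫ ω, (edgeIndicator G (U ω ∩ Hᶜ) - edgeIndicator G (U ω ∩ H)) ∂μ
      - (p * y) ^ 2 * (edgesIn G Hᶜ - edgesIn G H)| ≤ 10 * y * (p * y) ^ 2 * edgesIn G univ := by
  have hp := h.pos
  have hy2 : y ^ 2 ≤ 1 / 4096 := by nlinarith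
  have hL := abs_integral_edgeIndicator_sub_le (G := G) hp hy0 (by linarith) hU
    (A := Hᶜ) (fun v hv => by
      refine le_trans ?_ (h.light_deg v hv)
      unfold rdeg
      gcongr
      exact degIn_mono G (subset_univ _) v) (by linarith [h.light_edges])
  have hc := h.card_heavy
  have hdeg : ∀ v, (degIn G H v : ℝ) ≤ H.card := fun v => by
    exact_mod_cast degIn_le_card G H v
  have hHe : p ^ 2 * edgesIn G H ≤ 1 := by
    have h1 : edgesIn G H ≤ (H.card : ℝ) * H.card := by
      unfold edgesIn
      rw [card_adjPairs]
      have : ∑ u ∈ H, (degIn G H u : ℝ) ≤ ∑ u ∈ H, (H.card : ℝ) := sum_le_sum fun v _ => hdeg v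
      rw [sum_const, nsmul_eq_mul] at this
      have h0 : (0 : ℝ) ≤ H.card * H.card := by positivity
      linarith
    have h2 : (0 : ℝ) ≤ p * H.card := by positivity
    calc p ^ 2 * edgesIn G H ≤ p ^ 2 * ((H.card : ℝ) * H.card) := by gcongr
      _ = (p * H.card) * (p * H.card) := by ring
      _ ≤ 1 := by nlinarith
  have hH := abs_integral_edgeIndicator_sub_le (G := G) hp hy0 (by linarith) hU
    (A := H) (fun v _ => by
      refine (mul_le_mul_of_nonneg_left (hdeg v) hp.le).trans ?_
      linarith) hHe
  rw [integral_sub Integrable.of_finite Integrable.of_finite]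
  have e1 := edgesIn_mono (G := G) (subset_univ Hᶜ)
  have e2 := edgesIn_mono (G := G) (subset_univ H)
  have hc0 : 0 ≤ 5 * y * (p * y) ^ 2 := by positivity
  have f1 := mul_le_mul_of_nonneg_left e1 hc0
  have f2 := mul_le_mul_of_nonneg_left e2 hc0
  rw [abs_le] at hL hH ⊢
  constructor <;> linarith [hL.1, hL.2, hH.1, hH.2]

end GoodSplit

end Groups

/-! ### The stages and their stopping rule -/

section Stages

/-- A stage that satisfies the stopping rule is accurate. Here `v` is the number of its groups times
the rate `p`, and `W` its total weight, with expectation `v * M`. Either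
disjunct of the stopping rule forces `v * m` to exceed `12 * x ^ 4 * D`, where `D` bounds the
weights, and then the standard deviation of `W / v` is much smaller than `m / x`. -/
theorem abs_stage_sub_le {x n m p v M D W : ℝ} (hx : 64 ≤ x) (hn : 0 < n) (hm : 0 < m) (hv : 0 < v)
    (hp : 0 < p) (hedges : (1 / x) ^ 2 ≤ 32 * p ^ 2 * m) (hM : M ≤ 3 * m)
    (hDn : D ≤ 2 * n) (hDm : D ≤ 3 * m)
    (hdev : (W - v * M) ^ 2 ≤ 4 * x ^ 2 * (v * (D * (3 * m))))
    (hhalts : x ^ 8 ≤ v ∨ x ^ 8 * n ≤ W + v / p ^ 2) : |W / v - M| ≤ m / x := by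
  have hx0 : 0 < x := by linarith
  have hx2 : 4096 ≤ x ^ 2 := by nlinarith
  have hx4 : 0 < x ^ 4 := by positivity
  have hx48 : 4096 * x ^ 4 ≤ x ^ 8 := by
    have : x ^ 8 = x ^ 4 * (x ^ 2) ^ 2 := by ring
    have h16 : 4096 ≤ (x ^ 2) ^ 2 := by nlinarith
    rw [this, mul_comm]; gcongr
  have key : 12 * x ^ 4 * D ≤ v * m := by
    rcases hhalts with h | h
    · calc 12 * x ^ 4 * D ≤ 12 * x ^ 4 * (3 * m) := by gcongr
        _ = 36 * x ^ 4 * m := by ring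
        _ ≤ v * m := by gcongr; linarith
    · have hD : 12 * x ^ 4 * D ≤ 24 * x ^ 4 * n := by
        calc 12 * x ^ 4 * D ≤ 12 * x ^ 4 * (2 * n) := by gcongr
          _ = _ := by ring
      refine hD.trans ?_
      rcases le_total (x ^ 8 * n / 2) (v / p ^ 2) with h1 | h1
      · rw [le_div_iff₀ (by positivity)] at h1
        have h2 : 1 ≤ 32 * p ^ 2 * m * x ^ 2 := by
          rw [div_pow, one_pow, div_le_iff₀ (by positivity)] at hedges
          exact hedges
        have h3 : x ^ 8 * n / 2 * p ^ 2 * m ≤ v * m := by gcongr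
        have h4 : x ^ 6 * n / 64 * 1 ≤ x ^ 6 * n / 64 * (32 * p ^ 2 * m * x ^ 2) := by gcongr
        have h5 : x ^ 6 * n / 64 * (32 * p ^ 2 * m * x ^ 2) = x ^ 8 * n / 2 * p ^ 2 * m := by ring
        have h6 : 4096 * (x ^ 4 * n) ≤ x ^ 2 * (x ^ 4 * n) := by gcongr
        have h7 : x ^ 2 * (x ^ 4 * n) = x ^ 6 * n := by ring
        have h8 : 0 < x ^ 4 * n := by positivity
        linarith
      · by_contra hcon
        push Not at hcon
        have hW : x ^ 8 * n / 2 ≤ W := by linarith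
        have h0 : 0 < x ^ 4 * n := by positivity
        have h1 : v * M ≤ 3 * (v * m) := by nlinarith
        have h48 : 4096 * (x ^ 4 * n) ≤ x ^ 8 * n := by nlinarith
        have h2 : x ^ 8 * n / 4 ≤ W - v * M := by linarith
        have h3 : (x ^ 8 * n / 4) ^ 2 ≤ (W - v * M) ^ 2 := by
          have : 0 ≤ x ^ 8 * n / 4 := by positivity
          gcongr
        have h4 : 4 * x ^ 2 * (v * (D * (3 * m))) ≤ 24 * x ^ 2 * n * (v * m) := by
          have : 4 * x ^ 2 * (v * (D * (3 * m))) ≤ 4 * x ^ 2 * (v * (2 * n * (3 * m))) := by gcongr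
          linarith
        have h5 : 24 * x ^ 2 * n * (v * m) ≤ 24 * x ^ 2 * n * (24 * x ^ 4 * n) := by gcongr
        have h6 : (x ^ 8 * n / 4) ^ 2 ≤ 576 * (x ^ 2 * (x ^ 4 * n ^ 2)) := by linarith
        have h7 : (x ^ 8 * n / 4) ^ 2 = x ^ 8 * (x ^ 2 * (x ^ 2 * (x ^ 4 * n ^ 2))) / 16 := by ring
        have h8 : 0 < x ^ 2 * (x ^ 4 * n ^ 2) := by positivity
        have h9 : 4096 * (x ^ 2 * (x ^ 4 * n ^ 2)) ≤ x ^ 2 * (x ^ 2 * (x ^ 4 * n ^ 2)) := by gcongr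
        have h10 : 4096 ≤ x ^ 8 := by
          have : 1 ≤ x ^ 4 := one_le_pow₀ (by linarith)
          linarith
        have h11 : 4096 * (x ^ 2 * (x ^ 2 * (x ^ 4 * n ^ 2)))
            ≤ x ^ 8 * (x ^ 2 * (x ^ 2 * (x ^ 4 * n ^ 2))) := by gcongr
        linarith
  have hsq : (W / v - M) ^ 2 ≤ (m / x) ^ 2 := by
    have h1 : (W / v - M) ^ 2 = (W - v * M) ^ 2 / v ^ 2 := by field_simp
    rw [h1, div_le_iff₀ (by positivity)]
    refine hdev.trans ?_
    have h2 : (m / x) ^ 2 * v ^ 2 = (v * m) * (v * m) / x ^ 2 := by field_simp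
    rw [h2, le_div_iff₀ (by positivity)]
    calc 4 * x ^ 2 * (v * (D * (3 * m))) * x ^ 2 = (12 * x ^ 4 * D) * (v * m) := by ring
      _ ≤ _ := by gcongr
  exact abs_le_of_sq_le_sq hsq (by positivity)

/-- A stage that does not satisfy the stopping rule has few groups. -/
theorem stage_size_le {x n m p v M D W : ℝ} (hx : 64 ≤ x) (hn : 0 < n) (hm : 0 < m) (hv : 0 < v)
    (hM : m ≤ 2 * M + 1 / p ^ 2) (hW : 0 ≤ W) (hDn : D ≤ 2 * n)
    (hp : 0 < p) (hdev : (W - v * M) ^ 2 ≤ 4 * x ^ 2 * (v * (D * (3 * m))))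
    (hhalts : W + v / p ^ 2 ≤ x ^ 8 * n) : v * m ≤ 4 * x ^ 8 * n := by
  have hx0 : 0 < x := by linarith
  have hx2 : 4096 ≤ x ^ 2 := by nlinarith
  by_contra hcon
  push Not at hcon
  have h1 : v * m ≤ 2 * (v * M) + v / p ^ 2 := by
    calc v * m ≤ v * (2 * M + 1 / p ^ 2) := by gcongr
      _ = _ := by ring
  have hvp : 0 ≤ v / p ^ 2 := by positivity
  have h2 : v * m / 8 ≤ v * M - W := by linarith
  have h3 : (v * m / 8) ^ 2 ≤ (v * M - W) ^ 2 := by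
    have : 0 ≤ v * m / 8 := by positivity
    gcongr
  have h4 : 4 * x ^ 2 * (v * (D * (3 * m))) ≤ 24 * x ^ 2 * n * (v * m) := by
    have : 4 * x ^ 2 * (v * (D * (3 * m))) ≤ 4 * x ^ 2 * (v * (2 * n * (3 * m))) := by gcongr
    linarith
  have h5 : (v * m) * (v * m) ≤ (1536 * x ^ 2 * n) * (v * m) := by
    linarith [show (v * M - W) ^ 2 = (W - v * M) ^ 2 by ring,
      show (v * m / 8) ^ 2 = (v * m) * (v * m) / 64 by ring]
  have h6 : v * m ≤ 1536 * x ^ 2 * n := le_of_mul_le_mul_right h5 (by positivity)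
  have h7 : 4096 * (x ^ 2 * n) ≤ x ^ 8 * n := by
    have h8 : x ^ 8 * n = (x ^ 2) ^ 3 * (x ^ 2 * n) := by ring
    rw [h8]
    have : 4096 ≤ (x ^ 2) ^ 3 := by nlinarith [pow_le_pow_left₀ (by norm_num) hx2 3]
    gcongr
  have : 0 < x ^ 2 * n := by positivity
  linarith

/-- The lower bound on the number of edges certified by the choice of the rate `p`. -/
theorem one_div_rate_le {x p m : ℝ} (hx : 0 < x) (hp : 0 < p) (hm : 0 < m)
    (hedges : (1 / x) ^ 2 ≤ 32 * p ^ 2 * m) : 1 / p ≤ 6 * x * √m := by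
  have hsq : √m * √m = m := Real.mul_self_sqrt hm.le
  rw [div_pow, one_pow, div_le_iff₀ (by positivity)] at hedges
  have h2 : 1 ≤ (6 * x * √m * p) ^ 2 := by
    have : (6 * x * √m * p) ^ 2 = 36 * x ^ 2 * (√m * √m) * p ^ 2 := by ring
    rw [this, hsq]
    have h0 : 0 ≤ x ^ 2 * m * p ^ 2 := by positivity
    linarith
  rw [div_le_iff₀ hp]
  exact (one_le_sq_iff₀ (by positivity)).1 h2

/-- The number of groups in the stage after one that does not satisfy the stopping rule. The two
disjuncts of the rule account for the two terms of the minimum. -/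
theorem two_mul_stage_le {x n p m T : ℝ} (hx : 0 < x) (hp : 0 < p) (hm : 0 < m) (hn : 0 < n)
    (hpm : 1 / p ≤ 6 * x * √m) (hT1 : T ≤ x ^ 8 * (1 / p)) (hT2 : T * p * m ≤ 4 * x ^ 8 * n) :
    2 * T ≤ 48 * x ^ 9 * min √m (n / √m) := by
  have hsm : 0 < √m := Real.sqrt_pos.2 hm
  have hsq : √m * √m = m := Real.mul_self_sqrt hm.le
  rw [mul_min_of_nonneg _ _ (by positivity)]
  refine le_min ?_ ?_
  · have h1 : x ^ 8 * (1 / p) ≤ x ^ 8 * (6 * x * √m) := by gcongr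
    have h2 : x ^ 8 * (6 * x * √m) = 6 * (x ^ 9 * √m) := by ring
    have h3 : 0 ≤ x ^ 9 * √m := by positivity
    linarith
  · have h1 : T * m ≤ 4 * x ^ 8 * n * (1 / p) := by
      rw [mul_one_div, le_div_iff₀ hp]
      linarith
    have h2 : 4 * x ^ 8 * n * (1 / p) ≤ 4 * x ^ 8 * n * (6 * x * √m) := by gcongr
    have h3 : T * √m * √m ≤ 24 * x ^ 9 * n * √m := by
      rw [mul_assoc, hsq]; linarith
    have h4 := le_of_mul_le_mul_right h3 hsm
    rw [← mul_div_assoc, le_div_iff₀ hsm]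
    linarith

theorem total_cost_le {x μ T c₁ c₂ c₃ : ℝ} (hx : 64 ≤ x) (hμ : 1 ≤ μ) (hT : T ≤ 48 * x ^ 9 * μ)
    (h₁ : c₁ ≤ 3 * x ^ 7) (h₂ : c₂ ≤ 3 * x ^ 21) (h₃ : c₃ ≤ 48 * x ^ 10 * T) :
    c₁ + c₂ + c₃ ≤ μ * x ^ 22 := by
  have h7 : x ^ 7 ≤ x ^ 21 := pow_le_pow_right₀ (by linarith) (by norm_num)
  have h19 : 48 * x ^ 10 * T ≤ 48 * x ^ 10 * (48 * x ^ 9 * μ) := by gcongr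
  have h21 : 48 * x ^ 10 * (48 * x ^ 9 * μ) ≤ x ^ 21 * μ := by
    have h2 : 2304 ≤ x ^ 2 := by nlinarith
    calc 48 * x ^ 10 * (48 * x ^ 9 * μ) = 2304 * (x ^ 19 * μ) := by ring
      _ ≤ x ^ 2 * (x ^ 19 * μ) := by gcongr
      _ = _ := by ring
  have h21' : x ^ 21 ≤ x ^ 21 * μ := le_mul_of_one_le_right (by positivity) hμ
  have h22 : 7 * (x ^ 21 * μ) ≤ μ * x ^ 22 :=
    calc 7 * (x ^ 21 * μ) ≤ x * (x ^ 21 * μ) := by gcongr; linarith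
      _ = _ := by ring
  linarith

end Stages

/-! ### The whole algorithm and its behaviour on good samples -/

section Main

variable {n : ℕ}

/-- The whole algorithm with its random sets given: `S`, `S'` are the test sets for each rate
`2 ^ (-j)`, `R`, `Q` the sets for comparing light and heavy edges, and `V` those for the stages.
The rate `p = 2 ^ (-j₀)` that is used is the first one at which the union of two test sets rarely
contains an edge. Stage `t` adds up the degree estimates of the heavy vertices of `2 ^ t` sets of
rate `p`. The output is the estimate of the sum of the degrees of the heavy vertices, plus that of
the difference between the numbers of edges among the light and among the heavy vertices. -/
noncomputable def edgeCountProg (x : ℕ) {J B K L : ℕ} (S S' : Fin (J + 1) → Fin K → Finset (Fin n))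
    (R Q : Fin (J + 1) → Fin L → Finset (Fin n))
    (V : Fin (J + 1) → (t : Fin B) → Fin (2 ^ (t : ℕ)) → Finset (Fin n)) : Prog n ℝ :=
  (Prog.tabulate fun j => (Prog.sum univ fun i => Prog.edgeInd (S j i ∪ S' j i)).bind
    fun s => .pure (s / K)).bind fun β =>
  let j₀ := leastIdx fun j => β j ≤ (1 / x) ^ 2
  (Prog.sum univ fun i => lightMinusHeavyProg x (S j₀) (R j₀ i) (Q j₀ i)).bind fun z =>
  (stageLoop (fun t => Prog.sum univ fun i => weightProg x S j₀ (V j₀ t i))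
    (fun t W => (x : ℝ) ^ 8 * 2 ^ (j₀ : ℕ) ≤ 2 ^ (t : ℕ) ∨
      (x : ℝ) ^ 8 * n ≤ W + 2 ^ (t : ℕ) * 2 ^ (j₀ : ℕ))
    (fun t W => W / (2 ^ (t : ℕ) * (1 / 2) ^ (j₀ : ℕ))) (List.finRange B)).bind fun W =>
  .pure (W + z / L * (2 ^ (j₀ : ℕ) * x) ^ 2)

/-- The frequency of an edge in the union of two test sets. -/
noncomputable def pairFreq (G : SimpleGraph (Fin n)) {K : ℕ} (S S' : Fin K → Finset (Fin n)) : ℝ :=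
  (∑ i, edgeIndicator G (S i ∪ S' i)) / K

theorem pow_le_two_pow_of_large {x : ℕ} (hx : 64 ≤ x) : x ^ 10 ≤ 2 ^ x := by
  induction x, hx using Nat.le_induction with
  | base => norm_num
  | succ k hk ih =>
    have h1 : (k + 1) ^ 10 ≤ 2 * k ^ 10 := by
      have hk' : (64 : ℝ) ≤ k := by exact_mod_cast hk
      have h2 : ((k : ℝ) + 1) ≤ (1 + 1 / 64) * k := by linarith
      have h3 : ((k : ℝ) + 1) ^ 10 ≤ ((1 + 1 / 64) * k) ^ 10 := by gcongr
      have h4 : ((1 + 1 / 64) * (k : ℝ)) ^ 10 ≤ 2 * (k : ℝ) ^ 10 := by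
        rw [mul_pow]; gcongr; norm_num
      exact_mod_cast h3.trans h4
    rw [pow_succ 2 k]
    linarith

/-- The behaviour of the algorithm, when its samples are good. The error is made up of `1 / x`
from the last stage, `6 / x` from the degree estimates and `11 / x` from the light and the heavy
edges. -/
theorem edgeCountProg_spec {G : SimpleGraph (Fin n)} {x : ℕ} (hx : 64 ≤ x) (hn : n ≤ 2 ^ x)
    {K L : ℕ} (hK : K = x ^ 6)
    {S S' : Fin (2 * x + 1) → Fin K → Finset (Fin n)}
    {R Q : Fin (2 * x + 1) → Fin L → Finset (Fin n)}
    {V : Fin (2 * x + 1) → (t : Fin (4 * x)) → Fin (2 ^ (t : ℕ)) → Finset (Fin n)}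
    {j₀ : Fin (2 * x + 1)} (hj₀ : j₀ = leastIdx fun j => pairFreq G (S j) (S' j) ≤ (1 / x) ^ 2)
    (hm : 1 ≤ edgesIn G univ)
    (hsplit : GoodSplit G (1 / x) (halfPow j₀) (heavySet G (S j₀)) (degEst G x S j₀))
    (hZ : |(∑ i, (lightMinusHeavyProg x (S j₀) (R j₀ i) (Q j₀ i)).run (indepSetOracle G)) / L
        * (2 ^ (j₀ : ℕ) * x) ^ 2 - (edgesIn G (heavySet G (S j₀))ᶜ - edgesIn G (heavySet G (S j₀)))|
      ≤ 11 / x * edgesIn G univ)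
    (hcZ : ((∑ i, (lightMinusHeavyProg x (S j₀) (R j₀ i) (Q j₀ i)).cost (indepSetOracle G) : ℕ) : ℝ)
      ≤ 3 * (x : ℝ) ^ 21)
    (hW : ∀ t : Fin (4 * x),
      (∑ i, (weightProg x S j₀ (V j₀ t i)).run (indepSetOracle G)
        - 2 ^ (t : ℕ) * (halfPow j₀ : ℝ) * ∑ v ∈ heavySet G (S j₀), degEst G x S j₀ v) ^ 2
      ≤ 4 * (x : ℝ) ^ 2 * (2 ^ (t : ℕ) * (halfPow j₀ : ℝ) *
          (min (2 * (n : ℝ)) (3 * edgesIn G univ) * (3 * edgesIn G univ))))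
    (hcW : ∀ t : Fin (4 * x),
      ((∑ i, (weightProg x S j₀ (V j₀ t i)).cost (indepSetOracle G) : ℕ) : ℝ)
        ≤ 12 * (x : ℝ) ^ 9 * 2 ^ (t : ℕ)) :
    |(edgeCountProg x S S' R Q V).run (indepSetOracle G) - edgesIn G univ|
        ≤ 18 / x * edgesIn G univ ∧
      ((edgeCountProg x S S' R Q V).cost (indepSetOracle G) : ℝ)
        ≤ min √(edgesIn G univ) (n / √(edgesIn G univ)) * (x : ℝ) ^ 22 := by
  set f := indepSetOracle G with hf
  set m := edgesIn G univ with hmdef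
  set p : ℝ := (halfPow (j₀ : ℕ) : unitInterval).1 with hp
  set H := heavySet G (S j₀) with hH
  set M := ∑ v ∈ H, degEst G x S j₀ v with hMdef
  have hxR : (64 : ℝ) ≤ x := by exact_mod_cast hx
  have hx0 : (0 : ℝ) < x := by linarith
  have hy0 : (0 : ℝ) < 1 / x := by positivity
  have hy : (1 : ℝ) / x ≤ 1 / 64 := by gcongr
  have hp0 : 0 < p := halfPow_pos _
  have hm0 : 0 < m := by linarith
  have hnpos : 0 < n := by
    obtain ⟨u, -, -⟩ := exists_adj_of_edgesIn_pos hm0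
    exact u.pos
  have hnR : (0 : ℝ) < n := by exact_mod_cast hnpos
  have hp2 : (2 : ℝ) ^ (j₀ : ℕ) = 1 / p := by rw [hp, coe_halfPow]; simp
  have hpp : (1 / 2 : ℝ) ^ (j₀ : ℕ) = p := rfl
  let W : Fin (4 * x) → Prog n ℝ := fun t => Prog.sum univ fun i => weightProg x S j₀ (V j₀ t i)
  let halts : Fin (4 * x) → ℝ → Prop := fun t W => (x : ℝ) ^ 8 * 2 ^ (j₀ : ℕ) ≤ 2 ^ (t : ℕ) ∨
      (x : ℝ) ^ 8 * n ≤ W + 2 ^ (t : ℕ) * 2 ^ (j₀ : ℕ)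
  let out : Fin (4 * x) → ℝ → ℝ := fun t W => W / (2 ^ (t : ℕ) * (1 / 2) ^ (j₀ : ℕ))
  have hWrun : ∀ t, (W t).run f = ∑ i, (weightProg x S j₀ (V j₀ t i)).run f := fun t => by simp [W]
  have hWcost : ∀ t, (W t).cost f = ∑ i, (weightProg x S j₀ (V j₀ t i)).cost f :=
    fun t => by simp [W]
  -- the last stage satisfies the stopping rule, as `x ^ 8 * 2 ^ (2 * x) ≤ 2 ^ (4 * x - 1)`
  have hex : ∃ t ∈ List.finRange (4 * x), halts t ((W t).run f) := by
    refine ⟨⟨4 * x - 1, by omega⟩, List.mem_finRange _, Or.inl ?_⟩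
    have h1 : x ^ 8 ≤ 2 ^ x := (Nat.pow_le_pow_right (by omega) (by norm_num)).trans
      (pow_le_two_pow_of_large hx)
    have h2 : 2 ^ (j₀ : ℕ) ≤ 2 ^ (2 * x) :=
      Nat.pow_le_pow_right (by norm_num) (Nat.lt_succ_iff.1 j₀.2)
    have h3 : x ^ 8 * 2 ^ (j₀ : ℕ) ≤ 2 ^ (4 * x - 1) :=
      calc x ^ 8 * 2 ^ (j₀ : ℕ) ≤ 2 ^ x * 2 ^ (2 * x) := Nat.mul_le_mul h1 h2
        _ = 2 ^ (x + 2 * x) := (pow_add _ _ _).symm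
        _ ≤ 2 ^ (4 * x - 1) := Nat.pow_le_pow_right (by norm_num) (by omega)
    exact_mod_cast h3
  obtain ⟨t, -, ht, hbefore, hrun, hcost⟩ :=
    stageLoop_spec f W halts out (List.pairwise_lt_finRange _) hex
  have hrunAll : (edgeCountProg x S S' R Q V).run f
      = (stageLoop W halts out (List.finRange (4 * x))).run f
      + (∑ i, (lightMinusHeavyProg x (S j₀) (R j₀ i) (Q j₀ i)).run f) / L
        * (2 ^ (j₀ : ℕ) * x) ^ 2 := by
    subst hj₀
    simp only [edgeCountProg, Prog.run_bind, Prog.run_tabulate, Prog.run_sum, Prog.run_pure]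
    rfl
  have hcostAll : (edgeCountProg x S S' R Q V).cost f = (2 * x + 1) * K
      + ∑ i, (lightMinusHeavyProg x (S j₀) (R j₀ i) (Q j₀ i)).cost f
      + (stageLoop W halts out (List.finRange (4 * x))).cost f := by
    subst hj₀
    simp only [edgeCountProg, Prog.cost_bind, Prog.run_bind, Prog.run_tabulate, Prog.run_sum,
      Prog.run_pure, Prog.cost_pure, Prog.cost_sum, Prog.cost_tabulate, Prog.cost_edgeInd,
      sum_const, card_univ, Fintype.card_fin, smul_eq_mul, mul_one, add_zero, ← add_assoc]
    rfl
  have hMle : M ≤ 3 * m := hsplit.sum_weight_le hy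
  have hMge : m ≤ 2 * M + 1 / p ^ 2 := hsplit.edgesIn_le_weight hy hy0.le
  have hW' : ∀ t, ((W t).run f - 2 ^ (t : ℕ) * p * M) ^ 2
      ≤ 4 * (x : ℝ) ^ 2 * (2 ^ (t : ℕ) * p * (min (2 * (n : ℝ)) (3 * m) * (3 * m))) := by
    intro t; rw [hWrun]; exact hW t
  have hT : ∀ t : Fin (4 * x), (2 : ℝ) ^ (t : ℕ) * 2 ^ (j₀ : ℕ) = 2 ^ (t : ℕ) * p / p ^ 2 := by
    intro t; rw [hp2]; field_simp
  constructor
  · have h1 : |out t ((W t).run f) - M| ≤ m / x := by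
      refine abs_stage_sub_le hxR hnR hm0 (v := 2 ^ (t : ℕ) * p) (by positivity) hp0
        hsplit.edges hMle (min_le_left _ _) (min_le_right _ _) (hW' t) ?_
      rcases ht with ht | ht
      · left
        rw [hp2, mul_one_div, div_le_iff₀ hp0] at ht
        exact ht
      · right
        rw [hT] at ht
        exact ht
    have h2 := hsplit.abs_sum_weight_sub_le hy0.le
    have h3 := edgesIn_univ_eq (G := G) H
    rw [hrunAll, hrun]
    have e1 : m / x = 1 / x * m := by ring
    have e2 : 11 / (x : ℝ) = 11 * (1 / x) := by ring
    have e3 : 18 / (x : ℝ) = 18 * (1 / x) := by ring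
    rw [e1] at h1
    rw [e2] at hZ
    rw [e3]
    rw [abs_le] at h1 h2 hZ ⊢
    constructor <;> linarith [h1.1, h1.2, h2.1, h2.2, hZ.1, hZ.2]
  · have hsm : 0 < √m := Real.sqrt_pos.2 hm0
    set μ := min √m (n / √m) with hμ
    have hmn : m ≤ (n : ℝ) ^ 2 := by
      have := edgesIn_le (G := G)
      have h0 : 0 ≤ (n : ℝ) ^ 2 := by positivity
      linarith
    have hμ1 : 1 ≤ μ := by
      refine le_min (Real.one_le_sqrt.2 hm) ?_
      rw [le_div_iff₀ hsm, one_mul]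
      exact Real.sqrt_le_iff.2 ⟨hnR.le, hmn⟩
    have hpm := one_div_rate_le hx0 hp0 hm0 hsplit.edges
    have ht2 : (2 : ℝ) ^ (t : ℕ) ≤ 48 * (x : ℝ) ^ 9 * μ := by
      rcases Nat.eq_zero_or_pos (t : ℕ) with h0 | h0
      · rw [h0, pow_zero]
        have h9 : (1 : ℝ) ≤ (x : ℝ) ^ 9 := one_le_pow₀ (by linarith)
        nlinarith
      · obtain ⟨k, hk⟩ := Nat.exists_eq_succ_of_ne_zero h0.ne'
        have hkB : k < 4 * x := by have := t.2; omega
        have hns := hbefore ⟨k, hkB⟩ (List.mem_finRange _) (by rw [Fin.lt_def]; simp [hk])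
        simp only [halts, not_or, not_le] at hns
        obtain ⟨hns1, hns2⟩ := hns
        have hWk0 : 0 ≤ (W ⟨k, hkB⟩).run f := by
          rw [hWrun]
          refine sum_nonneg fun i _ => ?_
          rw [hf, run_weightProg G hn]
          exact sum_nonneg fun v _ => degEst_nonneg G x S j₀ v
        have hTk := hT ⟨k, hkB⟩
        simp only at hTk
        rw [hTk] at hns2
        have hsize := stage_size_le hxR hnR hm0 (v := 2 ^ k * p) (by positivity) hMge hWk0
          (min_le_left _ _) hp0 (hW' ⟨k, hkB⟩) hns2.le
        rw [hp2] at hns1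
        have h2t : (2 : ℝ) ^ (t : ℕ) = 2 * 2 ^ k := by rw [hk, pow_succ]; ring
        rw [h2t]
        exact two_mul_stage_le hx0 hp0 hm0 hnR hpm hns1.le hsize
    have hloop : ((stageLoop W halts out (List.finRange (4 * x))).cost f : ℝ)
        ≤ 48 * (x : ℝ) ^ 10 * 2 ^ (t : ℕ) := by
      have h1 : ((stageLoop W halts out (List.finRange (4 * x))).cost f : ℝ)
          ≤ ∑ s ∈ (List.finRange (4 * x)).toFinset.filter (· ≤ t), ((W s).cost f : ℝ) := by
        exact_mod_cast hcost
      refine h1.trans ((sum_le_card_nsmul _ _ (12 * (x : ℝ) ^ 9 * 2 ^ (t : ℕ)) ?_).trans ?_)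
      · intro s hs
        rw [mem_filter] at hs
        rw [hWcost]
        refine (hcW s).trans ?_
        gcongr
        · norm_num
        · exact hs.2
      · have hc : (((List.finRange (4 * x)).toFinset.filter (· ≤ t)).card : ℝ) ≤ 4 * x := by
          have := card_le_univ ((List.finRange (4 * x)).toFinset.filter (· ≤ t))
          rw [Fintype.card_fin] at this
          exact_mod_cast this
        rw [nsmul_eq_mul]
        calc _ ≤ (4 * (x : ℝ)) * (12 * (x : ℝ) ^ 9 * 2 ^ (t : ℕ)) := by gcongr
          _ = _ := by ring
    have hK' : ((2 * x + 1) * K : ℝ) ≤ 3 * (x : ℝ) ^ 7 := by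
      rw [hK]
      push_cast
      have h6 : 0 < (x : ℝ) ^ 6 := by positivity
      nlinarith [show (x : ℝ) ^ 7 = x * x ^ 6 by ring]
    rw [hcostAll]
    push_cast at hcZ ⊢
    exact total_cost_le hxR hμ1 ht2 hK' hcZ hloop

end Main

/-! ### The samples are good with high probability -/

section Probability

section Embedding

variable {ι κ X : Type*} [Fintype ι] [Fintype κ] [Finite X] [MeasurableSpace X]
  [MeasurableSingletonClass X] {μ : ι → Measure X} [∀ i, IsProbabilityMeasure (μ i)]
  {ν : Measure X}

theorem markov_emb (e : κ ↪ ι) (hs : ∀ k, μ (e k) = ν) {g : X → ℝ} {E c : ℝ} (h0 : ∀ y, 0 ≤ g y)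
    (hE : ∫ y, g y ∂ν ≤ E) (hc : 0 < c) :
    (Measure.pi μ).real {ω | ¬ ∑ k, g (ω (e k)) ≤ c} ≤ Fintype.card κ * E / c := by
  have h := markov (μ := μ) (ν := ν) (s := univ.map e) (by simpa using hs) h0 hE hc
  simp only [sum_map, card_map, card_univ] at h
  refine (measureReal_mono fun ω hω => ?_).trans h
  rw [Set.mem_ofPred_eq] at hω ⊢
  exact (not_le.1 hω).le

variable [IsProbabilityMeasure ν]

theorem hoeffding_avg (e : κ ↪ ι) (hs : ∀ k, μ (e k) = ν) {g : X → ℝ} (h0 : ∀ y, 0 ≤ g y)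
    (h1 : ∀ y, g y ≤ 1) {θ : ℝ} (hθ : 0 ≤ θ) (hκ : 0 < Fintype.card κ) :
    (Measure.pi μ).real {ω | ¬ |(∑ k, g (ω (e k))) / Fintype.card κ - ∫ y, g y ∂ν| ≤ θ}
      ≤ 2 * Real.exp (-2 * Fintype.card κ * θ ^ 2) := by
  have h := hoeffding (μ := μ) (ν := ν) (s := univ.map e) (by simpa using hs) h0 h1 hθ
  simp only [sum_map, card_map, card_univ] at h
  refine (measureReal_mono fun ω hω => ?_).trans h
  rw [Set.mem_ofPred_eq] at hω ⊢
  have hc : (0 : ℝ) < Fintype.card κ := by exact_mod_cast hκ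
  have he : (∑ k, g (ω (e k))) / Fintype.card κ - ∫ y, g y ∂ν
      = (∑ k, g (ω (e k)) - Fintype.card κ * ∫ y, g y ∂ν) / Fintype.card κ := by
    field_simp
  rw [he, abs_div, abs_of_pos hc, div_le_iff₀ hc] at hω
  exact (not_le.1 hω).le

theorem chebyshev_emb (e : κ ↪ ι) (hs : ∀ k, μ (e k) = ν) {g : X → ℝ} {V c : ℝ}
    (hV : ∫ y, g y ^ 2 ∂ν - (∫ y, g y ∂ν) ^ 2 ≤ V) (hc : 0 < c) :
    (Measure.pi μ).real {ω | ¬ |∑ k, g (ω (e k)) - Fintype.card κ * ∫ y, g y ∂ν| ≤ c}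
      ≤ Fintype.card κ * V / c ^ 2 := by
  have h := chebyshev (μ := μ) (ν := ν) (s := univ.map e) (by simpa using hs) hV hc
  simp only [sum_map, card_map, card_univ] at h
  refine (measureReal_mono fun ω hω => ?_).trans h
  rw [Set.mem_ofPred_eq] at hω ⊢
  exact (not_le.1 hω).le

end Embedding

variable {n : ℕ}

/-- The law of two independent random sets for each rate `2 ^ (-j)` and each `i`, the first one of
this rate and the second one of rate `r j`. -/
noncomputable def pairLaw (n J K : ℕ) (r : ℕ → unitInterval) :
    Measure (Fin (J + 1) × Fin K → (Fin n → Bool) × (Fin n → Bool)) :=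
  Measure.pi fun i => (randSub n (halfPow i.1)).prod (randSub n (r i.1))

/-- The law of the random sets of the stages: `2 ^ t` sets of each rate `2 ^ (-j)` in stage `t`. -/
noncomputable def stageLaw (n J B : ℕ) :
    Measure (Fin (J + 1) × (Σ t : Fin B, Fin (2 ^ (t : ℕ))) → (Fin n → Bool)) :=
  Measure.pi fun i => randSub n (halfPow i.1)

instance (n J K : ℕ) (r : ℕ → unitInterval) : IsProbabilityMeasure (pairLaw n J K r) := by
  unfold pairLaw; infer_instance

instance (n J B : ℕ) : IsProbabilityMeasure (stageLaw n J B) := by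
  unfold stageLaw; infer_instance

/-- The embedding of the samples of a fixed rate into all samples. -/
def atIdx {α : Type*} (J : ℕ) (j : Fin (J + 1)) : α ↪ Fin (J + 1) × α :=
  ⟨fun i => (j, i), fun _ _ h => (Prod.mk.inj h).2⟩

theorem markov_pairLaw {J K : ℕ} {r : ℕ → unitInterval} (j : Fin (J + 1))
    {g : (Fin n → Bool) × (Fin n → Bool) → ℝ} {E c : ℝ} (h0 : ∀ y, 0 ≤ g y)
    (hE : ∫ y, g y ∂((randSub n (halfPow j)).prod (randSub n (r j))) ≤ E) (hc : 0 < c) :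
    (pairLaw n J K r).real {ω | ¬ ∑ i, g (ω (j, i)) ≤ c} ≤ K * E / c := by
  have h := markov_emb (atIdx J j) (μ := fun i : Fin (J + 1) × Fin K =>
    (randSub n (halfPow i.1)).prod (randSub n (r i.1))) (fun _ => rfl) h0 hE hc
  rwa [Fintype.card_fin] at h

theorem chebyshev_pairLaw {J K : ℕ} {r : ℕ → unitInterval} (j : Fin (J + 1))
    {ν : Measure ((Fin n → Bool) × (Fin n → Bool))}
    (hν : ν = (randSub n (halfPow j)).prod (randSub n (r j)))
    {g : (Fin n → Bool) × (Fin n → Bool) → ℝ} {V c : ℝ}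
    (hV : ∫ y, g y ^ 2 ∂ν - (∫ y, g y ∂ν) ^ 2 ≤ V) (hc : 0 < c) :
    (pairLaw n J K r).real {ω | ¬ |∑ i, g (ω (j, i)) - K * ∫ y, g y ∂ν| ≤ c} ≤ K * V / c ^ 2 := by
  subst hν
  have h := chebyshev_emb (atIdx J j) (μ := fun i : Fin (J + 1) × Fin K =>
    (randSub n (halfPow i.1)).prod (randSub n (r i.1))) (fun _ => rfl) hV hc
  rwa [Fintype.card_fin] at h

/-- The embedding of the samples of a fixed rate and stage into all samples. -/
def atStage (J B : ℕ) (j : Fin (J + 1)) (t : Fin B) :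
    Fin (2 ^ (t : ℕ)) ↪ Fin (J + 1) × (Σ t : Fin B, Fin (2 ^ (t : ℕ))) :=
  ⟨fun i => (j, ⟨t, i⟩), fun _ _ h => by simpa using h⟩

/-- A union bound over the frequencies at all rates: at each one there are `n + 2` of them. -/
theorem hoeffding_numeric {x n : ℕ} (hx : 64 ≤ x) (hn : n ≤ 2 ^ x) :
    ((2 * x + 1 : ℕ) : ℝ) * ((n + 2 : ℕ) : ℝ)
      * (2 * Real.exp (-2 * (x ^ 6 : ℕ) * ((1 / (x : ℝ)) ^ 2 / 2) ^ 2)) ≤ 1 / x := by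
  have hxR : (64 : ℝ) ≤ x := by exact_mod_cast hx
  have hx0 : (0 : ℝ) < x := by linarith
  have h1 : -2 * ((x ^ 6 : ℕ) : ℝ) * ((1 / (x : ℝ)) ^ 2 / 2) ^ 2 = -((x : ℝ) ^ 2 / 2) := by
    push_cast; field_simp
  have h2 : Real.exp (-((x : ℝ) ^ 2 / 2)) ≤ Real.exp (-(6 * x)) := by
    rw [Real.exp_le_exp]; nlinarith
  have hE : (x : ℝ) + 1 ≤ Real.exp x := Real.add_one_le_exp x
  have hE2 : (2 : ℝ) ^ x ≤ Real.exp x := by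
    have h3 : (2 : ℝ) ≤ Real.exp 1 := by linarith [Real.exp_one_gt_d9]
    calc (2 : ℝ) ^ x ≤ Real.exp 1 ^ x := by gcongr
      _ = Real.exp x := by rw [← Real.exp_nat_mul, mul_one]
  have hnR : (n : ℝ) ≤ 2 ^ x := by exact_mod_cast hn
  have h6 : Real.exp (-(6 * (x : ℝ))) = 1 / Real.exp x ^ 6 := by
    rw [Real.exp_neg, ← Real.exp_nat_mul, one_div]; norm_num
  set E := Real.exp x with hEdef
  have hE1 : 1 ≤ E := by linarith
  rw [h1, le_div_iff₀ hx0]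
  push_cast
  calc (2 * (x : ℝ) + 1) * (n + 2) * (2 * Real.exp (-((x : ℝ) ^ 2 / 2))) * x
      ≤ (2 * E) * (2 * E) * (2 * (1 / E ^ 6)) * E := by
        rw [← h6]; gcongr <;> linarith
    _ = 8 / E ^ 3 := by field_simp; norm_num
    _ ≤ 1 := by
        rw [div_le_one (by positivity)]
        have : (64 : ℝ) ^ 3 ≤ E ^ 3 := by gcongr; linarith
        linarith

theorem integral_prod_fst {α β : Type*} [MeasurableSpace α] [MeasurableSpace β]
    [Finite α] [Finite β] [MeasurableSingletonClass α] [MeasurableSingletonClass β]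
    (μ : Measure α) (ν : Measure β) [IsProbabilityMeasure μ] [IsProbabilityMeasure ν] (g : α → ℝ) :
    ∫ y, g y.1 ∂(μ.prod ν) = ∫ a, g a ∂μ := by
  rw [integral_prod _ Integrable.of_finite]; simp

/-- The test frequencies are accurate with high probability. -/
theorem real_not_goodTests_le (G : SimpleGraph (Fin n)) {x : ℕ} (hx : 64 ≤ x) (hn : n ≤ 2 ^ x) :
    (pairLaw n (2 * x) (x ^ 6) halfPow).real {ω | ¬ GoodTests G (1 / (x : ℝ))
      (fun j => pairFreq G (fun i => supp (ω (j, i)).1) (fun i => supp (ω (j, i)).2))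
      (fun j i => supp (ω (j, i)).1)} ≤ 1 / x := by
  set θ : ℝ := (1 / (x : ℝ)) ^ 2 / 2 with hθ
  have hθ0 : 0 ≤ θ := by positivity
  have hK : 0 < Fintype.card (Fin (x ^ 6)) := by rw [Fintype.card_fin]; positivity
  let law := fun j : Fin (2 * x + 1) => (randSub n (halfPow j)).prod (randSub n (halfPow j))
  -- `none` stands for the pairs of test sets, `some none` for random sets, `some (some v)` for `v`
  let g : Fin (2 * x + 1) → Option (Option (Fin n)) → (Fin n → Bool) × (Fin n → Bool) → ℝ :=
    fun j o y => match o with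
      | none => edgeIndicator G (supp y.1 ∪ supp y.2)
      | some none => hitProb G (halfPow j) (supp y.1)
      | some (some v) => edgeIndicator G (supp y.1 ∪ {v})
  have hg0 : ∀ j o y, 0 ≤ g j o y := by
    rintro j (_ | _ | v) y
    · exact edgeIndicator_nonneg G _
    · exact hitProb_nonneg _
    · exact edgeIndicator_nonneg G _
  have hg1 : ∀ j o y, g j o y ≤ 1 := by
    rintro j (_ | _ | v) y
    · exact edgeIndicator_le_one G _
    · have := integral_mono (μ := randSub n (halfPow j)) Integrable.of_finite Integrable.of_finite
        fun b => edgeIndicator_le_one G (supp b ∪ supp y.1)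
      simpa [g, hitProb] using this
    · exact edgeIndicator_le_one G _
  let bad : Fin (2 * x + 1) × Option (Option (Fin n)) →
      Set (Fin (2 * x + 1) × Fin (x ^ 6) → (Fin n → Bool) × (Fin n → Bool)) := fun jo =>
    {ω | ¬ |(∑ k, g jo.1 jo.2 (ω (atIdx (2 * x) jo.1 k))) / Fintype.card (Fin (x ^ 6))
      - ∫ y, g jo.1 jo.2 y ∂(law jo.1)| ≤ θ}
  have hbad : ∀ jo, (pairLaw n (2 * x) (x ^ 6) halfPow).real (bad jo)
      ≤ 2 * Real.exp (-2 * Fintype.card (Fin (x ^ 6)) * θ ^ 2) := fun jo =>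
    hoeffding_avg (atIdx (2 * x) jo.1) (fun _ => rfl) (hg0 jo.1 jo.2) (hg1 jo.1 jo.2) hθ0 hK
  have hsub : {ω | ¬ GoodTests G (1 / (x : ℝ))
      (fun j => pairFreq G (fun i => supp (ω (j, i)).1) (fun i => supp (ω (j, i)).2))
      (fun j i => supp (ω (j, i)).1)} ⊆ ⋃ jo, bad jo := by
    intro ω hω
    rw [Set.mem_ofPred_eq] at hω
    by_contra hcon
    simp only [Set.mem_iUnion, bad, Set.mem_ofPred_eq, not_exists, not_not] at hcon
    refine hω ⟨fun j => ?_, fun j v => ?_, fun j => ?_⟩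
    · have := hcon (j, none)
      simp only [Fintype.card_fin] at this
      exact this
    · have := hcon (j, some (some v))
      have hm : ∫ y, g j (some (some v)) y ∂(law j) = hitProb G (halfPow j) {v} :=
        integral_prod_fst _ _ fun a => edgeIndicator G (supp a ∪ {v})
      rw [hm, Fintype.card_fin] at this
      exact this
    · have := hcon (j, some none)
      have hm : ∫ y, g j (some none) y ∂(law j) = pairProb G (halfPow j) := by
        rw [pairProb_eq]
        exact integral_prod_fst _ _ fun a => hitProb G (halfPow j) (supp a)
      have hf : ∫ b, hitFreq G (fun i => supp (ω (j, i)).1) (supp b) ∂(randSub n (halfPow j))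
          = (∑ k, g j (some none) (ω (atIdx (2 * x) j k))) / (x ^ 6 : ℕ) := by
        unfold hitFreq
        rw [integral_div, integral_finsetSum _ fun _ _ => Integrable.of_finite]
        congr 1
        refine sum_congr rfl fun i _ => ?_
        simp only [g, hitProb, union_comm]
        rfl
      rw [hm, Fintype.card_fin] at this
      rw [hf]
      exact this
  refine (measureReal_mono hsub).trans ((measureReal_iUnion_fintype_le bad).trans ?_)
  refine (sum_le_sum fun jo _ => hbad jo).trans (le_of_eq_of_le ?_ (hoeffding_numeric hx hn))
  rw [sum_const, card_univ, Fintype.card_prod, Fintype.card_option, Fintype.card_option,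
    Fintype.card_fin, Fintype.card_fin, Fintype.card_fin, nsmul_eq_mul]
  push_cast
  ring

/-- The rate `1 / x`, which is `0` for `x = 0`. -/
noncomputable def invRate (x : ℕ) : unitInterval :=
  ⟨1 / x, by positivity, by
    rw [one_div]; exact Nat.cast_inv_le_one x⟩

variable {G : SimpleGraph (Fin n)} {x : ℕ} {S : Fin (2 * x + 1) → Fin (x ^ 6) → Finset (Fin n)}
  {j₀ : Fin (2 * x + 1)}

theorem integral_descentCost_heavy_le (hn : n ≤ 2 ^ x)
    (hheavy : (randSub n (halfPow j₀)).real {b | 1 / 2 ≤ hitFreq G (S j₀) (supp b)} ≤ 1 / 2) :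
    ∫ b, descentCost (x ^ 6) (fun U => 1 / 2 ≤ hitFreq G (S j₀) U) (supp b) x 0
      ∂(randSub n (halfPow j₀)) ≤ 2 * (x : ℝ) ^ 7 := by
  refine (integral_descentCost_univ_le hn (halfPow j₀) (x ^ 6)
    (heavy := fun U => 1 / 2 ≤ hitFreq G (S j₀) U)
    (fun U V hUV h => h.trans (hitFreq_mono G _ hUV)) hheavy).trans (le_of_eq ?_)
  push_cast; ring

/-- If a sum of `x ^ 13` samples is close to `x ^ 13 * I`, and `I` is close to `q ^ 2 * W` for the
rate `q = p / x`, then the rescaled average of the samples is close to `W`. -/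
theorem abs_rescaled_sub_le {x p m Z I W : ℝ} (hx : 0 < x) (hp : 0 < p)
    (hm : (1 / x) ^ 2 ≤ 32 * p ^ 2 * m)
    (hZ : |Z - x ^ 13 * I| ≤ x ^ 13 * (1 / (32 * x ^ 5)))
    (hI : |I - (p * (1 / x)) ^ 2 * W| ≤ 10 * (1 / x) * (p * (1 / x)) ^ 2 * m) :
    |Z / x ^ 13 * (1 / (p * (1 / x)) ^ 2) - W| ≤ 11 / x * m := by
  have hL : 0 < x ^ 13 := by positivity
  set q := p * (1 / x) with hq
  have hq0 : 0 < q := by positivity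
  have h3 : |Z / x ^ 13 - I| ≤ 1 / (32 * x ^ 5) := by
    have h4 : Z / x ^ 13 - I = (Z - x ^ 13 * I) / x ^ 13 := by field_simp
    rw [h4, abs_div, abs_of_pos hL, div_le_iff₀ hL, mul_comm (1 / _)]
    exact hZ
  have h5 : 1 / (32 * x ^ 5) ≤ q ^ 2 * (1 / x * m) := by
    calc 1 / (32 * x ^ 5) = (1 / x) ^ 2 * (1 / (32 * x ^ 3)) := by field_simp
      _ ≤ 32 * p ^ 2 * m * (1 / (32 * x ^ 3)) := by gcongr
      _ = _ := by rw [hq]; field_simp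
  have h7 : Z / x ^ 13 * (1 / q ^ 2) - W = (Z / x ^ 13 - q ^ 2 * W) / q ^ 2 := by field_simp
  rw [h7, abs_div, abs_of_pos (by positivity : 0 < q ^ 2), div_le_iff₀ (by positivity)]
  have h8 : 11 / x * m * q ^ 2 = q ^ 2 * (1 / x * m) + 10 * (1 / x) * q ^ 2 * m := by ring
  rw [h8]
  exact (abs_sub_le _ I _).trans (add_le_add (h3.trans h5) hI)

/-- The samples for comparing light and heavy edges are good with high probability. -/
theorem real_not_goodGroups_le (hx : 64 ≤ x) (hn : n ≤ 2 ^ x)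
    (hsplit : GoodSplit G (1 / x) (halfPow j₀) (heavySet G (S j₀)) (degEst G x S j₀))
    (hheavy : (randSub n (halfPow j₀)).real {b | 1 / 2 ≤ hitFreq G (S j₀) (supp b)} ≤ 1 / 2) :
    (pairLaw n (2 * x) (x ^ 13) fun _ => invRate x).real {ω | ¬ (
      |(∑ i, (lightMinusHeavyProg x (S j₀) (supp (ω (j₀, i)).1) (supp (ω (j₀, i)).2)).run
        (indepSetOracle G)) / (x ^ 13 : ℕ) * (2 ^ (j₀ : ℕ) * x) ^ 2
        - (edgesIn G (heavySet G (S j₀))ᶜ - edgesIn G (heavySet G (S j₀)))|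
      ≤ 11 / x * edgesIn G univ ∧
      ((∑ i, (lightMinusHeavyProg x (S j₀) (supp (ω (j₀, i)).1) (supp (ω (j₀, i)).2)).cost
        (indepSetOracle G) : ℕ) : ℝ) ≤ 3 * (x : ℝ) ^ 21)} ≤ 2 / x := by
  have hxR : (64 : ℝ) ≤ x := by exact_mod_cast hx
  have hx0 : (0 : ℝ) < x := by linarith
  set p : ℝ := (halfPow (j₀ : ℕ) : unitInterval).1 with hp
  have hp0 : 0 < p := halfPow_pos _
  set H := heavySet G (S j₀) with hH
  let ν := (randSub n (halfPow j₀)).prod (randSub n (invRate x))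
  have hrate : HasRate ν (fun y => supp y.1 ∩ supp y.2) (p * (1 / x)) :=
    (hasRate_randSub n _).prod (hasRate_randSub n _)
  let g : (Fin n → Bool) × (Fin n → Bool) → ℝ := fun y =>
    edgeIndicator G (supp y.1 ∩ supp y.2 ∩ Hᶜ) - edgeIndicator G (supp y.1 ∩ supp y.2 ∩ H)
  let d : (Fin n → Bool) × (Fin n → Bool) → ℝ := fun y =>
    (x ^ 6 : ℕ) + descentCost (x ^ 6) (fun U => 1 / 2 ≤ hitFreq G (S j₀) U) (supp y.1) x 0 + 2
  have hV : ∫ y, g y ^ 2 ∂ν - (∫ y, g y ∂ν) ^ 2 ≤ 1 := by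
    have h1 : ∫ y, g y ^ 2 ∂ν ≤ ∫ _, (1 : ℝ) ∂ν := by
      refine integral_mono Integrable.of_finite Integrable.of_finite fun y => ?_
      have a1 := edgeIndicator_nonneg G (supp y.1 ∩ supp y.2 ∩ Hᶜ)
      have a2 := edgeIndicator_le_one G (supp y.1 ∩ supp y.2 ∩ Hᶜ)
      have a3 := edgeIndicator_nonneg G (supp y.1 ∩ supp y.2 ∩ H)
      have a4 := edgeIndicator_le_one G (supp y.1 ∩ supp y.2 ∩ H)
      exact (sq_le_one_iff_abs_le_one _).2
        (abs_le.2 ⟨by simp only [g]; linarith, by simp only [g]; linarith⟩)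
    have h2 : ∫ _, (1 : ℝ) ∂ν = 1 := by simp
    have := sq_nonneg (∫ y, g y ∂ν)
    linarith
  have hd : ∫ y, d y ∂ν ≤ 3 * (x : ℝ) ^ 7 := by
    have h1 := integral_descentCost_heavy_le hn hheavy
    have h2 := integral_prod_fst (randSub n (halfPow j₀)) (randSub n (invRate x)) fun a =>
      ((x ^ 6 : ℕ) : ℝ)
        + descentCost (x ^ 6) (fun U => 1 / 2 ≤ hitFreq G (S j₀) U) (supp a) x 0 + 2
    refine h2.trans_le ?_
    rw [integral_add Integrable.of_finite Integrable.of_finite,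
      integral_add Integrable.of_finite Integrable.of_finite, integral_const, integral_const,
      probReal_univ, one_smul, one_smul]
    push_cast
    have h6 : 1 ≤ (x : ℝ) ^ 6 := one_le_pow₀ (by linarith)
    nlinarith [show (x : ℝ) ^ 7 = x * x ^ 6 by ring]
  have hL : (0 : ℝ) < (x : ℝ) ^ 13 := by positivity
  have hch := chebyshev_pairLaw (K := x ^ 13) (r := fun _ => invRate x) j₀ (ν := ν) rfl hV
    (c := (x : ℝ) ^ 13 * (1 / (32 * (x : ℝ) ^ 5))) (by positivity)
  have hma := markov_pairLaw (K := x ^ 13) (r := fun _ => invRate x) j₀ (g := d) (fun y => by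
      have := descentCost_nonneg (x ^ 6) (fun U => 1 / 2 ≤ hitFreq G (S j₀) U) (supp y.1) x 0
      simp only [d]; positivity) hd (c := 3 * (x : ℝ) ^ 21) (by positivity)
  have hch' : ((x ^ 13 : ℕ) : ℝ) * 1 / ((x : ℝ) ^ 13 * (1 / (32 * (x : ℝ) ^ 5))) ^ 2 ≤ 1 / x := by
    push_cast
    have h1 : (x : ℝ) ^ 13 * 1 / ((x : ℝ) ^ 13 * (1 / (32 * (x : ℝ) ^ 5))) ^ 2
        = 1024 / (x : ℝ) ^ 3 := by
      field_simp; norm_num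
    rw [h1, div_le_div_iff₀ (by positivity) hx0]
    nlinarith [show (x : ℝ) ^ 3 = x * x * x by ring, mul_pos hx0 hx0]
  have hma' : ((x ^ 13 : ℕ) : ℝ) * (3 * (x : ℝ) ^ 7) / (3 * (x : ℝ) ^ 21) = 1 / x := by
    push_cast; field_simp
  have h2x : (2 : ℝ) / x = 1 / x + 1 / x := by ring
  rw [h2x]
  have hbad := (measureReal_union_le _ _).trans
    (add_le_add (hch.trans hch') (hma.trans hma'.le))
  refine (measureReal_mono ?_).trans hbad
  intro ω hω
  by_contra hcon
  rw [Set.mem_union, Set.mem_ofPred_eq, Set.mem_ofPred_eq, not_or, not_not, not_not] at hcon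
  obtain ⟨h1, h2⟩ := hcon
  rw [Set.mem_ofPred_eq] at hω
  refine hω ⟨?_, ?_⟩
  · simp only [run_lightMinusHeavyProg G (S j₀) hn, ← hH]
    have hI := hsplit.abs_integral_lightMinusHeavy_sub_le (by gcongr) (by positivity) hrate
    have hp2 : (2 : ℝ) ^ (j₀ : ℕ) = 1 / p := by rw [hp, coe_halfPow]; simp
    have hr : (2 ^ (j₀ : ℕ) * (x : ℝ)) ^ 2 = 1 / (p * (1 / x)) ^ 2 := by
      rw [hp2]; field_simp
    rw [Nat.cast_pow] at h1
    rw [hr, Nat.cast_pow]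
    exact abs_rescaled_sub_le hx0 hp0 hsplit.edges h1 hI
  · push_cast
    simp only [cost_lightMinusHeavyProg G (S j₀)]
    exact h2

/-- The samples of the stages are good with high probability. -/
theorem real_not_goodStages_le (hx : 64 ≤ x) (hn : n ≤ 2 ^ x) (hn0 : 0 < n)
    (hsplit : GoodSplit G (1 / x) (halfPow j₀) (heavySet G (S j₀)) (degEst G x S j₀))
    (hheavy : (randSub n (halfPow j₀)).real {b | 1 / 2 ≤ hitFreq G (S j₀) (supp b)} ≤ 1 / 2) :
    (stageLaw n (2 * x) (4 * x)).real {ω | ¬ ∀ t : Fin (4 * x),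
      (∑ i, (weightProg x S j₀ (supp (ω (j₀, ⟨t, i⟩)))).run (indepSetOracle G)
        - 2 ^ (t : ℕ) * (halfPow j₀ : ℝ) * ∑ v ∈ heavySet G (S j₀), degEst G x S j₀ v) ^ 2
      ≤ 4 * (x : ℝ) ^ 2 * (2 ^ (t : ℕ) * (halfPow j₀ : ℝ) *
          (min (2 * (n : ℝ)) (3 * edgesIn G univ) * (3 * edgesIn G univ))) ∧
      ((∑ i, (weightProg x S j₀ (supp (ω (j₀, ⟨t, i⟩)))).cost (indepSetOracle G) : ℕ) : ℝ)
        ≤ 12 * (x : ℝ) ^ 9 * 2 ^ (t : ℕ)} ≤ 2 / x := by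
  have hxR : (64 : ℝ) ≤ x := by exact_mod_cast hx
  have hx0 : (0 : ℝ) < x := by linarith
  have hy : 1 / (x : ℝ) ≤ 1 / 64 := by gcongr
  set m := edgesIn G univ with hm
  have hm0 : 0 < m := hsplit.edgesIn_pos (by positivity)
  have hnR : (0 : ℝ) < n := by exact_mod_cast hn0
  set p : ℝ := (halfPow (j₀ : ℕ) : unitInterval).1 with hp
  have hp0 : 0 < p := halfPow_pos _
  set H := heavySet G (S j₀) with hH
  set D := min (2 * (n : ℝ)) (3 * m) with hD
  have hD0 : 0 < D := lt_min (by positivity) (by positivity)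
  let ν := randSub n (halfPow j₀)
  have hrate : HasRate ν supp p := hasRate_randSub n _
  let g : (Fin n → Bool) → ℝ := fun b => ∑ v ∈ supp b ∩ H, degEst G x S j₀ v
  let d : (Fin n → Bool) → ℝ := fun b =>
    (x ^ 6 : ℕ) + descentCost (x ^ 6) (fun U => 1 / 2 ≤ hitFreq G (S j₀) U) (supp b) x 0
      + (supp b ∩ H).card * (((2 * x : ℕ) + 1) * (x ^ 6 : ℕ))
  have hg : ∫ y, g y ∂ν = p * ∑ v ∈ H, degEst G x S j₀ v := integral_sum_inter hrate H _
  have hV : ∫ y, g y ^ 2 ∂ν - (∫ y, g y ∂ν) ^ 2 ≤ p * (D * (3 * m)) := by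
    refine (integral_sum_inter_sq_sub_le hrate hp0.le (D := D)
      (fun v _ => degEst_nonneg G x S j₀ v) fun v hv => ?_).trans ?_
    · have h1 := hsplit.weight_le hy hv
      exact le_min (by linarith [rdeg_le (G := G) v, rdeg_nonneg G v])
        (by linarith [rdeg_le_two_mul (G := G) v])
    · have := hsplit.sum_weight_le hy
      gcongr
  have hd : ∫ y, d y ∂ν ≤ 3 * (x : ℝ) ^ 7 := by
    have h1 := integral_descentCost_heavy_le hn hheavy
    have h2 := integral_card_inter hrate H
    simp only [d]
    rw [integral_add Integrable.of_finite Integrable.of_finite,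
      integral_add Integrable.of_finite Integrable.of_finite, integral_const,
      probReal_univ, one_smul, integral_mul_const, h2]
    have h3 : p * H.card * (((2 * x : ℕ) + 1) * ((x ^ 6 : ℕ) : ℝ)) ≤ (x : ℝ) ^ 6 := by
      have h4 := hsplit.card_heavy
      have h5 : p * H.card * (2 * x + 1) ≤ 5 * (1 / x) ^ 2 * (2 * x + 1) := by gcongr
      have h6 : 5 * (1 / (x : ℝ)) ^ 2 * (2 * x + 1) ≤ 1 := by
        rw [div_pow, one_pow, mul_one_div, div_mul_eq_mul_div, div_le_one (by positivity)]
        nlinarith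
      push_cast
      calc p * H.card * ((2 * x + 1) * (x : ℝ) ^ 6)
          = p * H.card * (2 * x + 1) * (x : ℝ) ^ 6 := by ring
        _ ≤ 1 * (x : ℝ) ^ 6 := by gcongr; exact h5.trans h6
        _ = _ := one_mul _
    push_cast at h3 ⊢
    have h6 : 1 ≤ (x : ℝ) ^ 6 := one_le_pow₀ (by linarith)
    nlinarith [show (x : ℝ) ^ 7 = x * x ^ 6 by ring]
  let c : Fin (4 * x) → ℝ := fun t => √(4 * (x : ℝ) ^ 2 * (2 ^ (t : ℕ) * (p * (D * (3 * m)))))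
  have hc0 : ∀ t, 0 < c t := fun t => Real.sqrt_pos.2 (by positivity)
  have hc2 : ∀ t, c t ^ 2 = 4 * (x : ℝ) ^ 2 * (2 ^ (t : ℕ) * (p * (D * (3 * m)))) := fun t =>
    Real.sq_sqrt (by positivity)
  have hstage : ∀ t : Fin (4 * x), (stageLaw n (2 * x) (4 * x)).real
      ({ω | ¬ |∑ k, g (ω (atStage (2 * x) (4 * x) j₀ t k)) - 2 ^ (t : ℕ) * ∫ y, g y ∂ν| ≤ c t} ∪
        {ω | ¬ ∑ k, d (ω (atStage (2 * x) (4 * x) j₀ t k)) ≤ 12 * (x : ℝ) ^ 9 * 2 ^ (t : ℕ)})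
      ≤ 1 / (2 * (x : ℝ) ^ 2) := by
    intro t
    have hch := chebyshev_emb (atStage (2 * x) (4 * x) j₀ t)
      (μ := fun i => randSub n (halfPow i.1)) (ν := ν) (fun _ => rfl) hV (hc0 t)
    have hma := markov_emb (atStage (2 * x) (4 * x) j₀ t)
      (μ := fun i => randSub n (halfPow i.1)) (ν := ν) (fun _ => rfl) (g := d) (fun y => by
        have := descentCost_nonneg (x ^ 6) (fun U => 1 / 2 ≤ hitFreq G (S j₀) U) (supp y) x 0
        simp only [d]; positivity) hd (c := 12 * (x : ℝ) ^ 9 * 2 ^ (t : ℕ)) (by positivity)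
    rw [Fintype.card_fin] at hch hma
    push_cast at hch hma
    have h1 : (2 : ℝ) ^ (t : ℕ) * (p * (D * (3 * m))) / c t ^ 2 = 1 / (4 * (x : ℝ) ^ 2) := by
      rw [hc2]; field_simp
    have h2 : (2 : ℝ) ^ (t : ℕ) * (3 * (x : ℝ) ^ 7) / (12 * (x : ℝ) ^ 9 * 2 ^ (t : ℕ))
        = 1 / (4 * (x : ℝ) ^ 2) := by field_simp; norm_num
    rw [h1] at hch
    rw [h2] at hma
    refine (measureReal_union_le _ _).trans ((add_le_add hch hma).trans (le_of_eq ?_))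
    field_simp; norm_num
  refine (measureReal_mono (s₂ := ⋃ t, _) ?_).trans ((measureReal_iUnion_fintype_le _).trans
    ((sum_le_sum fun t _ => hstage t).trans (le_of_eq ?_)))
  · intro ω hω
    by_contra hcon
    simp only [Set.mem_iUnion, Set.mem_union, Set.mem_ofPred_eq, not_exists, not_or,
      not_not] at hcon
    refine hω fun t => ?_
    obtain ⟨h1, h2⟩ := hcon t
    constructor
    · simp only [run_weightProg G hn]
      rw [hg, ← mul_assoc] at h1
      have h3 := sq_le_sq' (by linarith [(abs_le.1 h1).1]) (abs_le.1 h1).2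
      rw [hc2] at h3
      refine h3.trans (le_of_eq ?_)
      ring
    · push_cast
      simp only [cost_weightProg G hn]
      exact h2
  · rw [sum_const, card_univ, Fintype.card_fin, nsmul_eq_mul]
    push_cast
    field_simp
    norm_num

end Probability

/-! ### The randomized algorithm -/

section Final

variable {n : ℕ}

/-- The joint law of all random sets, for the accuracy parameter `x`. -/
noncomputable def sampleLaw (x n : ℕ) :=
  (pairLaw n (2 * x) (x ^ 6) halfPow).prod
    ((pairLaw n (2 * x) (x ^ 13) fun _ => invRate x).prod (stageLaw n (2 * x) (4 * x)))

instance (x n : ℕ) : IsProbabilityMeasure (sampleLaw x n) := by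
  unfold sampleLaw; infer_instance

/-- The algorithm as a function of its random samples. -/
noncomputable def sampleProg (x n : ℕ)
    (ω : (Fin (2 * x + 1) × Fin (x ^ 6) → (Fin n → Bool) × (Fin n → Bool)) ×
      (Fin (2 * x + 1) × Fin (x ^ 13) → (Fin n → Bool) × (Fin n → Bool)) ×
      (Fin (2 * x + 1) × (Σ t : Fin (4 * x), Fin (2 ^ (t : ℕ))) → (Fin n → Bool))) : Prog n ℝ :=
  edgeCountProg x (fun j i => supp (ω.1 (j, i)).1) (fun j i => supp (ω.1 (j, i)).2)
    (fun j i => supp (ω.2.1 (j, i)).1) (fun j i => supp (ω.2.1 (j, i)).2)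
    (fun j t i => supp (ω.2.2 (j, ⟨t, i⟩)))

/-- The randomized algorithm with accuracy parameter `x`. -/
noncomputable def edgeCountAlg (x n : ℕ) : RandQueryAlg n :=
  (sampleLaw x n).toPMF.map fun ω => (sampleProg x n ω).toTree

theorem prob_edgeCountAlg (x : ℕ) (G : SimpleGraph (Fin n)) (P : ℕ → ℝ → Prop) :
    (edgeCountAlg x n).prob G P = (sampleLaw x n).real
      {ω | P ((sampleProg x n ω).cost (indepSetOracle G))
        ((sampleProg x n ω).run (indepSetOracle G))} := by
  rw [RandQueryAlg.prob, edgeCountAlg, PMF.toOuterMeasure_map_apply,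
    ← PMF.toMeasure_apply_eq_toOuterMeasure, Measure.toPMF_toMeasure, measureReal_def]
  simp only [Set.preimage_ofPred_eq, Prog.numQueries_toTree, Prog.result_toTree]

/-- A bad event has small probability if it has small conditional probability for all good first
components. -/
theorem prod_real_le {α β : Type*} [MeasurableSpace α] [MeasurableSpace β] [Finite α] [Finite β]
    [MeasurableSingletonClass α] [MeasurableSingletonClass β] (μ : Measure α) (ν : Measure β)
    [IsProbabilityMeasure μ] [IsProbabilityMeasure ν] (B : α × β → Prop) (A : α → Prop) {a b : ℝ}
    (ha : μ.real {y | ¬ A y} ≤ a) (hb0 : 0 ≤ b) (hb : ∀ y, A y → ν.real {z | B (y, z)} ≤ b) :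
    (μ.prod ν).real {y | B y} ≤ a + b := by
  classical
  rw [← integral_ite_one_zero, integral_prod _ Integrable.of_finite]
  have h : ∀ y, ∫ z, (if B (y, z) then (1 : ℝ) else 0) ∂ν ≤ (if ¬ A y then 1 else 0) + b := by
    intro y
    rw [integral_ite_one_zero]
    by_cases hA : A y
    · rw [if_neg (not_not.2 hA), zero_add]
      exact hb y hA
    · rw [if_pos hA]
      linarith [measureReal_le_one (μ := ν) (s := {z | B (y, z)})]
  refine (integral_mono Integrable.of_finite Integrable.of_finite h).trans ?_
  rw [integral_add Integrable.of_finite Integrable.of_finite, integral_ite_one_zero,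
    integral_const, probReal_univ, one_smul]
  linarith

theorem two_pow_rate_bounds {x n : ℕ} (hx : 64 ≤ x) (hn : n ≤ 2 ^ x) :
    4 * (n : ℝ) ^ 2 * (halfPow (2 * x) : ℝ) ^ 2 ≤ (1 / (x : ℝ)) ^ 2 ∧
      4 * (n : ℝ) * (halfPow (2 * x) : ℝ) ≤ 1 / x := by
  have hxR : (64 : ℝ) ≤ x := by exact_mod_cast hx
  have hx0 : (0 : ℝ) < x := by linarith
  have hnR : (n : ℝ) ≤ 2 ^ x := by exact_mod_cast hn
  have h10 : (x : ℝ) ^ 10 ≤ 2 ^ x := by exact_mod_cast pow_le_two_pow_of_large hx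
  have h4 : 4 * (x : ℝ) ≤ 2 ^ x := by
    refine le_trans ?_ h10
    have : (64 : ℝ) ≤ (x : ℝ) ^ 9 := hxR.trans (le_self_pow₀ (by linarith) (by norm_num))
    nlinarith [show (x : ℝ) ^ 10 = x * x ^ 9 by ring]
  have hq : (halfPow (2 * x) : ℝ) = 1 / (2 ^ x * 2 ^ x) := by
    rw [coe_halfPow, one_div_pow, ← pow_add, two_mul]
  have h2 : 4 * (n : ℝ) * (halfPow (2 * x) : ℝ) ≤ 1 / x := by
    rw [hq, mul_one_div, div_le_div_iff₀ (by positivity) hx0]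
    calc 4 * (n : ℝ) * x = n * (4 * x) := by ring
      _ ≤ 2 ^ x * 2 ^ x := by gcongr
      _ = _ := (one_mul _).symm
  refine ⟨?_, h2⟩
  have h0 : 0 ≤ 4 * (n : ℝ) * (halfPow (2 * x) : ℝ) := by
    have := (halfPow_pos (2 * x)).le
    positivity
  have h3 := pow_le_pow_left₀ h0 h2 2
  have h5 : 0 ≤ (n : ℝ) ^ 2 * (halfPow (2 * x) : ℝ) ^ 2 := by positivity
  linarith [show (4 * (n : ℝ) * (halfPow (2 * x) : ℝ)) ^ 2
    = 16 * ((n : ℝ) ^ 2 * (halfPow (2 * x) : ℝ) ^ 2) by ring]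

/-- The three families of samples are bad with probability at most `1 / x`, `2 / x` and `2 / x`; the
last two are considered conditionally on the test sets, which determine the rate and the heavy
vertices. -/
theorem prob_edgeCountAlg_ge (G : SimpleGraph (Fin n)) {x : ℕ} (hx : 64 ≤ x) (hn : n ≤ 2 ^ x)
    (hm : 1 ≤ edgesIn G univ) :
    1 - 5 / (x : ℝ) ≤ (edgeCountAlg x n).prob G fun c r =>
      |r - edgesIn G univ| ≤ 18 / x * edgesIn G univ ∧
        (c : ℝ) ≤ min √(edgesIn G univ) (n / √(edgesIn G univ)) * (x : ℝ) ^ 22 := by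
  have hxR : (64 : ℝ) ≤ x := by exact_mod_cast hx
  have hy0 : (0 : ℝ) < 1 / x := by positivity
  have hy : 1 / (x : ℝ) ≤ 1 / 64 := by gcongr
  have hm0 : 0 < edgesIn G univ := by linarith
  have hn0 : 0 < n := by
    obtain ⟨u, -, -⟩ := exists_adj_of_edgesIn_pos hm0
    exact u.pos
  obtain ⟨hJ, hJ'⟩ := two_pow_rate_bounds hx hn
  rw [prob_edgeCountAlg]
  set good : Set _ := {ω | |(sampleProg x n ω).run (indepSetOracle G) - edgesIn G univ|
      ≤ 18 / x * edgesIn G univ ∧ ((sampleProg x n ω).cost (indepSetOracle G) : ℝ)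
        ≤ min √(edgesIn G univ) (n / √(edgesIn G univ)) * (x : ℝ) ^ 22} with hgood
  have hcompl := probReal_compl_eq_one_sub (μ := sampleLaw x n) (s := good)
    (Set.toFinite _).measurableSet
  suffices h : (sampleLaw x n).real goodᶜ ≤ 1 / x + (2 / x + 2 / x) by
    have : (5 : ℝ) / x = 1 / x + (2 / x + 2 / x) := by ring
    linarith
  refine prod_real_le _ _ (fun ω => ω ∉ good) _ (real_not_goodTests_le G hx hn) (by positivity)
    fun ω₁ h₁ => ?_
  set S : Fin (2 * x + 1) → Fin (x ^ 6) → Finset (Fin n) := fun j i => supp (ω₁ (j, i)).1 with hS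
  set S' : Fin (2 * x + 1) → Fin (x ^ 6) → Finset (Fin n) := fun j i => supp (ω₁ (j, i)).2 with hS'
  obtain ⟨j₀, hj₀⟩ : ∃ j₀, j₀ = leastIdx fun j => pairFreq G (S j) (S' j) ≤ (1 / (x : ℝ)) ^ 2 :=
    ⟨_, rfl⟩
  have hsplit := h₁.split hx rfl hm0 hJ hJ' hj₀
  have hheavy : (randSub n (halfPow j₀)).real {b | 1 / 2 ≤ hitFreq G (S j₀) (supp b)} ≤ 1 / 2 := by
    refine h₁.real_heavy_le hy hy0 ?_
    rw [hj₀]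
    exact (h₁.first_rate hy0 hy hm0 hJ).1
  refine prod_real_le _ _ (fun ω => (ω₁, ω) ∉ good) _
    (real_not_goodGroups_le hx hn hsplit hheavy) (by positivity) fun ω₂ h₂ => ?_
  refine (measureReal_mono fun ω₃ h₃ => ?_).trans
    (real_not_goodStages_le hx hn hn0 hsplit hheavy)
  rw [Set.mem_ofPred_eq] at h₃ ⊢
  intro hcon
  refine h₃ ?_
  rw [hgood, Set.mem_ofPred_eq]
  exact edgeCountProg_spec hx hn rfl hj₀ hm hsplit h₂.1 h₂.2 (fun t => (hcon t).1)
    fun t => (hcon t).2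

theorem ncard_edgeSet_eq (G : SimpleGraph (Fin n)) :
    (G.edgeSet.ncard : ℝ) = edgesIn G univ := by
  classical
  have h1 := G.sum_degrees_eq_twice_card_edges
  have h2 : G.edgeSet.ncard = G.edgeFinset.card := by
    rw [← SimpleGraph.coe_edgeFinset, Set.ncard_coe_finset]
  have h3 : ∀ v, G.degree v = degIn G univ v := by
    intro v
    rw [degIn, ← SimpleGraph.card_neighborFinset_eq_degree]
    congr 1
    ext u
    simp
  have h4 : (∑ v, (degIn G univ v : ℝ)) = 2 * G.edgeFinset.card := by
    exact_mod_cast (sum_congr rfl fun v _ => (h3 v).symm).trans h1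
  rw [h2, edgesIn, card_adjPairs, h4]
  ring

/-- An upper bound for the binary logarithm of `n` that is at least `64`. -/
noncomputable def logBound (n : ℕ) : ℕ := 2 * ⌈Real.log n⌉₊ + 64

theorem le_two_pow_logBound (n : ℕ) : n ≤ 2 ^ logBound n := by
  rcases Nat.eq_zero_or_pos n with rfl | hn
  · exact Nat.zero_le _
  have hnR : (0 : ℝ) < n := by exact_mod_cast hn
  have h : (n : ℝ) ≤ 2 ^ logBound n := by
    calc (n : ℝ) = Real.exp (Real.log n) := (Real.exp_log hnR).symm
      _ ≤ Real.exp ⌈Real.log n⌉₊ := Real.exp_le_exp.2 (Nat.le_ceil _)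
      _ = Real.exp 1 ^ ⌈Real.log n⌉₊ := by rw [← Real.exp_nat_mul, mul_one]
      _ ≤ (2 ^ 2) ^ ⌈Real.log n⌉₊ := by
          gcongr; linarith [Real.exp_one_lt_d9]
      _ = 2 ^ (2 * ⌈Real.log n⌉₊) := by rw [pow_mul]
      _ ≤ 2 ^ logBound n := pow_le_pow_right₀ (by norm_num) (by unfold logBound; omega)
  exact_mod_cast h

theorem logBound_le {n : ℕ} (hn : 0 < n) : (logBound n : ℝ) ≤ 2 * Real.log n + 66 := by
  have h := Nat.ceil_lt_add_one (Real.log_nonneg (show (1 : ℝ) ≤ n by exact_mod_cast hn))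
  unfold logBound
  push_cast
  linarith

theorem tendsto_div_logBound : Tendsto (fun n => 5 / (logBound n : ℝ)) atTop (𝓝 0) := by
  refine Tendsto.const_div_atTop ?_ 5
  refine tendsto_atTop_mono (fun n => ?_) (Real.tendsto_log_atTop.comp tendsto_natCast_atTop_atTop)
  have h := Nat.le_ceil (Real.log n)
  unfold logBound
  simp only [Function.comp]
  push_cast
  have h0 : (0 : ℝ) ≤ ⌈Real.log n⌉₊ := Nat.cast_nonneg _
  linarith

end Final

end EdgeCounting

theorem theorem1p1 :
    ∃ (A : (ε : ℝ) → (n : ℕ) → RandQueryAlg n) (P : MvPolynomial (Fin 2) ℝ) (δ : ℕ → ℝ),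
      Tendsto δ atTop (𝓝 0) ∧
      ∀ ε : ℝ, 0 < ε → ∀ n : ℕ, 0 < n → ∀ G : SimpleGraph (Fin n), ∀ m : ℕ,
        m = G.edgeSet.ncard → 1 ≤ m →
          1 - δ n ≤ (A ε n).prob G (fun q x =>
            (q : ℝ) ≤ min (√(m : ℝ)) ((n : ℝ) / √(m : ℝ)) *
                MvPolynomial.eval ![Real.log n, 1 / ε] P ∧
            (1 - ε) * (m : ℝ) ≤ x ∧ x ≤ (1 + ε) * (m : ℝ)) := by
  refine ⟨fun ε n => edgeCountAlg ((⌈18 / ε⌉₊ + 1) * logBound n) n,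
    ((MvPolynomial.C 18 * MvPolynomial.X 1 + MvPolynomial.C 2) *
      (MvPolynomial.C 2 * MvPolynomial.X 0 + MvPolynomial.C 66)) ^ 22,
    fun n => 5 / (logBound n : ℝ), tendsto_div_logBound, ?_⟩
  intro ε hε n hn G m hm hm1
  -- `18 / x ≤ ε` makes the output accurate, and `logBound n ≤ x` makes the error probability small
  set x := (⌈18 / ε⌉₊ + 1) * logBound n with hx
  have hmE : (m : ℝ) = edgesIn G Finset.univ := by rw [hm, ncard_edgeSet_eq]
  have h64 : 64 ≤ logBound n := by unfold logBound; omega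
  have hLx : logBound n ≤ x := Nat.le_mul_of_pos_left _ (Nat.succ_pos _)
  have hx64 : 64 ≤ x := h64.trans hLx
  have hL0 : (0 : ℝ) < logBound n := by exact_mod_cast (by omega : 0 < logBound n)
  have hx0 : (0 : ℝ) < x := by exact_mod_cast (by omega : 0 < x)
  have hnx : n ≤ 2 ^ x :=
    (le_two_pow_logBound n).trans (Nat.pow_le_pow_right (by norm_num) hLx)
  have h := prob_edgeCountAlg_ge G hx64 hnx (by rw [← hmE]; exact_mod_cast hm1)
  rw [← hmE] at h
  have hδ : 5 / (x : ℝ) ≤ 5 / logBound n := by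
    have : (logBound n : ℝ) ≤ x := by exact_mod_cast hLx
    gcongr
  refine (by linarith : 1 - 5 / (logBound n : ℝ) ≤ 1 - 5 / (x : ℝ)).trans (h.trans ?_)
  rw [prob_edgeCountAlg, prob_edgeCountAlg]
  refine MeasureTheory.measureReal_mono fun ω hω => ?_
  rw [Set.mem_ofPred_eq] at hω ⊢
  obtain ⟨h1, h2⟩ := hω
  have hm0 : (0 : ℝ) ≤ m := Nat.cast_nonneg m
  have hceil : (⌈18 / ε⌉₊ : ℝ) ≤ 18 / ε + 1 := (Nat.ceil_lt_add_one (by positivity)).le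
  constructor
  · refine h2.trans ?_
    have hxle : (x : ℝ) ≤ (18 * (1 / ε) + 2) * (2 * Real.log n + 66) := by
      rw [hx]
      push_cast
      have : 18 / ε = 18 * (1 / ε) := by ring
      exact mul_le_mul (by linarith) (logBound_le hn) hL0.le (by positivity)
    simp only [map_pow, map_mul, map_add, MvPolynomial.eval_C, MvPolynomial.eval_X,
      Matrix.cons_val_zero, Matrix.cons_val_one]
    gcongr
  · have hxε : 18 / (x : ℝ) ≤ ε := by
      rw [div_le_iff₀ hx0, mul_comm, ← div_le_iff₀ hε]
      have h3 : (⌈18 / ε⌉₊ : ℝ) ≤ x := by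
        have : ⌈18 / ε⌉₊ ≤ x :=
          (Nat.le_succ _).trans (Nat.le_mul_of_pos_right _ (by omega))
        exact_mod_cast this
      exact (Nat.le_ceil _).trans h3
    have h3 : 18 / (x : ℝ) * m ≤ ε * m := by gcongr
    rw [abs_le] at h1
    constructor <;> linarith [h1.1, h1.2]
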